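/- Consider a layered linear relay network over \(\mathbb F_2\) with layers \(1,\dots,M+1\), \(M\ge 2\), where layer \(m\) has \(K_m\ge 1\) nodes and \(K_1=K_{M+1}=K\). Node \(k\) of layer \(1\) is the source, and node \(k\) of layer \(M+1\) the destination, of the \(k\)-th source-destination pair. At each time \(t\) the nodes of layer \(m\) send \(\mathbf x_m[t]\in\mathbb F_2^{K_m}\) and the nodes of layer \(m+1\) receive \(\mathbf y_m[t]=\mathbf H_m[t]\,\mathbf x_m[t]\), where the entries of the random \(K_{m+1}\times K_m\) matrices \(\mathbf H_m[t]\) over \(\mathbb F_2\), \(1\le m\le M\), \(t\ge 1\), are independent and each equals \(1\) with probability \(1/2\). In a code of length \(n\) with rates \(R_1,\dots,R_K\ge 0\), source \(k\) has a message \(W_k\) uniformly distributed over \(\lceil 2^{nR_k}\rceil\) values, the messages being independent of each other and of the channels. At time \(t\le n\), source \(k\) sends a function of \(W_k\) and of \(\mathbf H_1[1],\dots,\mathbf H_1[t]\); node \(k\) of layer \(m\), \(2\le m\le M\), sends a function of its received symbols at the times \(1,\dots,t-1\) and of the matrices \(\mathbf H_l[\tau]\), \(l\le m\), \(\tau\le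 t\); destination \(k\) estimates \(W_k\) from its \(n\) received symbols and all the channel matrices. The rates \((R_1,\dots,R_K)\) are achievable if there is a sequence of such codes, one for each length \(n\), for which the error probability of every destination tends to \(0\) as \(n\to\infty\). The sum capacity \(C_{\mathrm{sum}}\) is the supremum of \(R_1+\dots+R_K\) over all achievable rates. Suppose that the network has a minimum-dimensional bottleneck hop \(m_0\in\{1,\dots,M\}\), that is, \(m_0\) minimizes \(\mathbb E(\operatorname{rank}\mathbf H_m)\) over \(m\in\{1,\dots,M\}\), and for every \(m\in\{1,\dots,M\}\) either \(K_m\ge K_{m_0}\) and \(K_{m+1}\ge K_{m_0+1}\), or \(K_m\ge K_{m_0+1}\) and \(K_{m+1}\ge K_{m_0}\). Then \[ C_{\mathrm{sum}}=\mathbb E(\operatorname{rank}\mathbf H_{m_0})=2^{-K_{m_0+1}K_{m_0}}\sum_{\mathbf H\in\mathbb F_2^{K_{m_0+1}\times K_{m_0}}}\operatorname{rank}(\mathbf H). \] -/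

import Mathlib

open Filter Topology

noncomputable section

/-- A layered linear relay network over the binary field with `M` hops.  Layers are numbered
`0, …, M` and hops `0, …, M - 1`; hop `m` goes from the `K m` nodes of layer `m` to the
`K (m + 1)` nodes of layer `m + 1` (the values `K m` with `m > M` play no role).
`p m j i` is the probability that the channel coefficient from node `i` of layer `m` to node `j`
of layer `m + 1` equals one. -/
structure RelayNetwork where
  M : ℕ
  M_pos : 0 < M
  K : ℕ → ℕ
  K_pos : ∀ m ≤ M, 0 < K m
  /-- there are as many destinations as sources -/
  K_last : K M = K 0
  p : (m : Fin M) → Fin (K (m + 1)) → Fin (K m) → ℝ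
  p_mem : ∀ m j i, p m j i ∈ Set.Icc (0 : ℝ) 1

namespace RelayNetwork

variable (N : RelayNetwork)

/-- Channel matrices of hop `m`. -/
abbrev ChannelMatrix (m : Fin N.M) : Type :=
  Matrix (Fin (N.K (m + 1))) (Fin (N.K m)) (ZMod 2)

/-- Realizations of all the channel matrices of all hops during `n` time slots:
`H t m` is the matrix of hop `m` at time `t`. -/
abbrev ChannelSeq (n : ℕ) : Type :=
  Fin n → (m : Fin N.M) → N.ChannelMatrix m

/-- Probability that the channel matrix of hop `m` equals `A`: the entries are independent
Bernoulli variables with parameters `p m j i`. -/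
def matrixProb (m : Fin N.M) (A : N.ChannelMatrix m) : ℝ :=
  ∏ j, ∏ i, if A j i = 1 then N.p m j i else 1 - N.p m j i

/-- Probability of a realization of the channels: independence over hops and over time. -/
def channelProb {n : ℕ} (H : N.ChannelSeq n) : ℝ :=
  ∏ t, ∏ m, N.matrixProb m (H t m)

/-- The average rank `𝔼 (rank H_m)` of the channel matrix of hop `m`. -/
def avgRank (m : Fin N.M) : ℝ :=
  ∑ A : N.ChannelMatrix m, N.matrixProb m A * (A.rank : ℝ)

/-- `m₀` is a minimum-dimensional bottleneck hop. -/
structure IsMinDimBottleneck (m₀ : Fin N.M) : Prop where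
  argmin : ∀ m, N.avgRank m₀ ≤ N.avgRank m
  dims : ∀ m : Fin N.M,
    (N.K m₀ ≤ N.K m ∧ N.K (m₀ + 1) ≤ N.K (m + 1)) ∨
    (N.K (m₀ + 1) ≤ N.K m ∧ N.K m₀ ≤ N.K (m + 1))

/-- The channel state information available at time `t` to the transmitters of hop `m`:
the matrices of the hops `0, …, m` at all times up to and including `t`. -/
abbrev CSI {n : ℕ} (m : Fin N.M) (t : Fin n) : Type :=
  {τ : Fin n // τ ≤ t} → (l : {l : Fin N.M // l ≤ m}) → N.ChannelMatrix l.1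

/-- The channel state information extracted from a realization of the channels. -/
def csi {n : ℕ} (H : N.ChannelSeq n) (m : Fin N.M) (t : Fin n) : N.CSI m t :=
  fun τ l => H τ.1 l.1

/-- The first hop. -/
def firstHop : Fin N.M := ⟨0, N.M_pos⟩

/-- The last hop. -/
def lastHop : Fin N.M := ⟨N.M - 1, Nat.sub_lt N.M_pos Nat.one_pos⟩

theorem K_lastHop : N.K (N.lastHop + 1) = N.K 0 := by
  have h : (N.lastHop : ℕ) + 1 = N.M := Nat.sub_add_cancel N.M_pos
  rw [h, N.K_last]

/-- The destination of source `k`: the `k`-th node of the last layer. -/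
def dest (k : Fin (N.K 0)) : Fin (N.K (N.lastHop + 1)) :=
  Fin.cast N.K_lastHop.symm k

/-- A block code of length `n` in which source `k` has `L k` messages. -/
structure Code (n : ℕ) (L : Fin (N.K 0) → ℕ) where
  /-- the symbol sent by source `k` at time `t`, from its message -/
  enc : (k : Fin (N.K 0)) → (t : Fin n) → Fin (L k) → N.CSI N.firstHop t → ZMod 2
  /-- the symbol sent by relay `k` of layer `m + 1` at time `t`, from the symbols that it has
  received before time `t` -/
  relay : (m : ℕ) → (hm : m + 1 < N.M) → Fin (N.K (m + 1)) → (t : Fin n) →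
    ({τ : Fin n // τ < t} → ZMod 2) → N.CSI ⟨m + 1, hm⟩ t → ZMod 2
  /-- the decision of destination `k`, from the symbols that it has received during the block -/
  dec : (k : Fin (N.K 0)) → (Fin n → ZMod 2) → N.ChannelSeq n → Fin (L k)

namespace Code

variable {N} {n : ℕ} {L : Fin (N.K 0) → ℕ} (c : N.Code n L)

/-- The signals `x_m[t]` sent by the nodes of layer `m`, when the messages are `W` and the channels
are `H`.  The signals received at the other end of hop `m` are `H t m *ᵥ x_m[t]`. -/
def tx (W : (k : Fin (N.K 0)) → Fin (L k)) (H : N.ChannelSeq n) :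
    (m : ℕ) → m < N.M → Fin n → Fin (N.K m) → ZMod 2
  | 0, _ => fun t k => c.enc k t (W k) (N.csi H N.firstHop t)
  | m + 1, hm => fun t k =>
      c.relay m hm k t
        (fun τ => (H τ.1 ⟨m, Nat.lt_of_succ_lt hm⟩).mulVec
          (tx W H m (Nat.lt_of_succ_lt hm) τ.1) k)
        (N.csi H ⟨m + 1, hm⟩ t)

/-- The signals `y_m[t] = H_m[t] x_m[t]` received over hop `m`. -/
def rx (W : (k : Fin (N.K 0)) → Fin (L k)) (H : N.ChannelSeq n) (m : Fin N.M) (t : Fin n) :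
    Fin (N.K (m + 1)) → ZMod 2 :=
  (H t m).mulVec (c.tx W H m m.isLt t)

/-- The message decided by destination `k`. -/
def decoded (W : (k : Fin (N.K 0)) → Fin (L k)) (H : N.ChannelSeq n) (k : Fin (N.K 0)) :
    Fin (L k) :=
  c.dec k (fun t => c.rx W H N.lastHop t (N.dest k)) H

/-- The probability of error at destination `k`, when the messages are independent of each other
and of the channels, and each is uniformly distributed. -/
def errorProb (k : Fin (N.K 0)) : ℝ :=
  ∑ W : (k : Fin (N.K 0)) → Fin (L k), ∑ H : N.ChannelSeq n,
    (∏ i, (L i : ℝ)⁻¹) * N.channelProb H * (if c.decoded W H k ≠ W k then 1 else 0)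

end Code

/-- The number of messages of a source of rate `r` in a block of length `n`; it is exactly
`2 ^ (n r)` when `n r` is a natural number. -/
def numMessages (n : ℕ) (r : ℝ) : ℕ := ⌈(2 : ℝ) ^ ((n : ℝ) * r)⌉₊

/-- The rate tuple `R` is achievable. -/
def Achievable (R : Fin (N.K 0) → ℝ) : Prop :=
  (∀ k, 0 ≤ R k) ∧
    ∃ c : (n : ℕ) → N.Code n (fun k => numMessages n (R k)),
      ∀ k, Tendsto (fun n => (c n).errorProb k) atTop (𝓝 0)

/-- `C` is the sum capacity: the supremum of the achievable sum rates. -/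
def IsSumCapacity (C : ℝ) : Prop :=
  IsLUB {s : ℝ | ∃ R : Fin (N.K 0) → ℝ, N.Achievable R ∧ s = ∑ k, R k} C

end RelayNetwork

end

/-! ### Finite product weights and Chebyshev's inequality -/

open Matrix

/-! Converse. Beyond a hop, the network sees the messages only through the signals received over
that hop. For fixed channels, at most `2 ^ ∑ t, (H t m).rank` message tuples can therefore be
decoded correctly (`Code.card_correct_le`). By Chebyshev the exponent concentrates at `n * avgRank
m`, which gives `Achievable.sum_le_avgRank`.

Achievability. Nodes cannot cooperate, so interference is undone by pairing channel matrices across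
hops. A frame consists of `r` active nodes and an invertible matrix `F`; its nodes send the
coordinates of `F z`. If the submatrix `A` between two frames satisfies `A F = F'`, the receiving
nodes obtain `F' z`. Prescribe a frame in every layer, the same one in the first and the last: each
active destination then receives exactly its source's bit, so the slot carries `r` bits.

Such chains can be matched with the channel matrices at every hop because the statistics agree.
Given rank `r`, a pivot block chosen from the row and column spaces is uniform on the invertible
matrices (`card_pivotBlock_eq`), and random relabelling makes the pivot nodes uniform, so all pairs
of frames joined by a hop have equal weight (`sum_coupling`). The dimension hypothesis puts a corner
of the bottleneck's size, possibly transposed, inside every hop; this corner is again uniform, so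
every hop can imitate the rank distribution of the bottleneck. Chains thus have the same weight at
all hops (`exists_chain_weights`). `exists_pick` rounds the weights to slots, a pipelined block code
uses them (`decoded_code`), and Chebyshev guarantees enough occurrences of every matrix. All
fractions `κ < 1` of the average rank follow (`achievable_sourceWeight`). -/

theorem sum_pi_prod {ι : Type*} [Fintype ι] [DecidableEq ι] {κ : ι → Type*} [∀ i, Fintype (κ i)]
    (f : (i : ι) → κ i → ℝ) :
    ∑ x : (i : ι) → κ i, ∏ i, f i (x i) = ∏ i, ∑ j, f i j := by
  classical
  rw [Finset.prod_univ_sum, Fintype.piFinset_univ]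

/-- Marginalization of a product weight. -/
theorem sum_pi_prod_mul {ι : Type*} [Fintype ι] [DecidableEq ι] {κ : ι → Type*}
    [∀ i, Fintype (κ i)] (P : (i : ι) → κ i → ℝ) (hP : ∀ i, ∑ x, P i x = 1) (i₀ : ι)
    (g : κ i₀ → ℝ) :
    ∑ x : (i : ι) → κ i, (∏ i, P i (x i)) * g (x i₀) = ∑ y, P i₀ y * g y := by
  classical
  have h1 : ∀ x : (i : ι) → κ i, (∏ i, P i (x i)) * g (x i₀)
      = ∏ i, (P i (x i) * if h : i = i₀ then g (h ▸ x i) else 1) := by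
    intro x
    rw [Finset.prod_mul_distrib]
    congr 1
    rw [Finset.prod_eq_single i₀]
    · simp
    · intro b _ hb; simp [hb]
    · simp
  rw [Finset.sum_congr rfl fun x _ => h1 x,
    sum_pi_prod (fun i y => P i y * if h : i = i₀ then g (h ▸ y) else 1),
    Finset.prod_eq_single i₀]
  · simp
  · intro b _ hb; simp [hb, hP]
  · simp

section IID

variable {Ω : Type*} [Fintype Ω] {n : ℕ} {P : Ω → ℝ}

theorem sum_iid_prod (hP1 : ∑ x, P x = 1) : ∑ H : Fin n → Ω, ∏ t, P (H t) = 1 := by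
  rw [sum_pi_prod (fun _ : Fin n => P)]; simp [hP1]

theorem sum_iid_mul_mul (hP1 : ∑ x, P x = 1) {h : Ω → ℝ} (h0 : ∑ x, P x * h x = 0) (a b : Fin n) :
    ∑ H : Fin n → Ω, (∏ t, P (H t)) * (h (H a) * h (H b))
      = if a = b then ∑ x, P x * h x ^ 2 else 0 := by
  by_cases hab : a = b
  · subst hab
    rw [if_pos rfl, ← sum_pi_prod_mul (fun _ : Fin n => P) (fun _ => hP1) a (fun x => h x ^ 2)]
    simp only [pow_two]
  · rw [if_neg hab]
    have h1 : ∀ x : Fin n → Ω, (∏ t, P (x t)) * (h (x a) * h (x b))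
        = ∏ t, (P (x t) * ((if t = a then h (x t) else 1) * if t = b then h (x t) else 1)) := by
      intro x
      rw [Finset.prod_mul_distrib, Finset.prod_mul_distrib]
      simp
    rw [Finset.sum_congr rfl fun x _ => h1 x,
      sum_pi_prod (fun (t : Fin n) x =>
        P x * ((if t = a then h x else 1) * if t = b then h x else 1))]
    exact Finset.prod_eq_zero (Finset.mem_univ a) (by simp [hab, h0])

/-- The second moment of a sum of independent centred variables. -/
theorem sum_iid_sq (hP1 : ∑ x, P x = 1) {h : Ω → ℝ} (h0 : ∑ x, P x * h x = 0)
    (S : Finset (Fin n)) :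
    ∑ H : Fin n → Ω, (∏ t, P (H t)) * (∑ t ∈ S, h (H t)) ^ 2 = S.card * ∑ x, P x * h x ^ 2 := by
  simp_rw [pow_two (∑ t ∈ S, h _), Finset.sum_mul_sum, Finset.mul_sum]
  rw [Finset.sum_comm]
  simp_rw [Finset.sum_comm (s := Finset.univ) (t := S), sum_iid_mul_mul hP1 h0]
  simp +contextual [Finset.mul_sum]

/-- Any event that forces a deviation is admitted, so one form serves the upper tail of the rank sum
in the converse and the lower tail of matrix counts in the scheme. The set `S` allows restriction to
one block. -/
theorem chebyshev_iid (hP0 : ∀ x, 0 ≤ P x) (hP1 : ∑ x, P x = 1) {g : Ω → ℝ} {μ V a : ℝ}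
    (hμ : ∑ x, P x * g x = μ) (hV : ∑ x, P x * (g x - μ) ^ 2 ≤ V) (ha : 0 < a)
    (S : Finset (Fin n)) (E : (Fin n → Ω) → Prop) [DecidablePred E]
    (hE : ∀ H, E H → a ≤ |∑ t ∈ S, g (H t) - S.card * μ|) :
    ∑ H : Fin n → Ω, (∏ t, P (H t)) * (if E H then 1 else 0) ≤ S.card * V / a ^ 2 := by
  have h0 : ∑ x, P x * (g x - μ) = 0 := by
    simp_rw [mul_sub, Finset.sum_sub_distrib, ← Finset.sum_mul, hP1, hμ]; ring
  have h2 := sum_iid_sq (n := n) hP1 h0 S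
  rw [le_div_iff₀ (by positivity)]
  calc _ = ∑ H : Fin n → Ω, (∏ t, P (H t)) * ((if E H then 1 else 0) * a ^ 2) := by
          rw [Finset.sum_mul]; exact Finset.sum_congr rfl fun _ _ => by ring
    _ ≤ ∑ H : Fin n → Ω, (∏ t, P (H t)) * (∑ t ∈ S, (g (H t) - μ)) ^ 2 := by
          refine Finset.sum_le_sum fun H _ => mul_le_mul_of_nonneg_left ?_
            (Finset.prod_nonneg fun _ _ => hP0 _)
          by_cases h : E H
          · have := hE H h
            rw [if_pos h, one_mul, Finset.sum_sub_distrib, Finset.sum_const, nsmul_eq_mul,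
              ← sq_abs (_ - _)]
            gcongr
          · simp only [if_neg h, zero_mul]; positivity
    _ = _ := h2
    _ ≤ _ := by gcongr

end IID

/-! ### The law of the channels -/

namespace RelayNetwork

variable (N : RelayNetwork)

theorem matrixProb_nonneg (m : Fin N.M) (A : N.ChannelMatrix m) : 0 ≤ N.matrixProb m A := by
  refine Finset.prod_nonneg fun j _ => Finset.prod_nonneg fun i _ => ?_
  have := N.p_mem m j i
  split_ifs
  · exact this.1
  · linarith [this.2]

theorem sum_matrixProb (m : Fin N.M) : ∑ A : N.ChannelMatrix m, N.matrixProb m A = 1 := by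
  have h := sum_pi_prod (ι := Fin (N.K (m + 1))) (κ := fun _ => Fin (N.K m) → ZMod 2)
    (fun j x => ∏ i, if x i = 1 then N.p m j i else 1 - N.p m j i)
  refine Eq.trans h (Finset.prod_eq_one fun j _ => ?_)
  rw [sum_pi_prod (ι := Fin (N.K m)) (κ := fun _ => ZMod 2)
    (fun i x => if x = 1 then N.p m j i else 1 - N.p m j i)]
  refine Finset.prod_eq_one fun i _ => ?_
  have : (Finset.univ : Finset (ZMod 2)) = {0, 1} := rfl
  rw [this]
  simp

/-- Probability of a realization of the channels of all hops in one time slot. -/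
def slotProb (ω : (m : Fin N.M) → N.ChannelMatrix m) : ℝ := ∏ m, N.matrixProb m (ω m)

theorem slotProb_nonneg (ω : (m : Fin N.M) → N.ChannelMatrix m) : 0 ≤ N.slotProb ω :=
  Finset.prod_nonneg fun m _ => N.matrixProb_nonneg m _

theorem sum_slotProb_mul (m : Fin N.M) (g : N.ChannelMatrix m → ℝ) :
    ∑ ω : (m : Fin N.M) → N.ChannelMatrix m, N.slotProb ω * g (ω m)
      = ∑ A, N.matrixProb m A * g A :=
  sum_pi_prod_mul N.matrixProb N.sum_matrixProb m g

theorem sum_slotProb : ∑ ω : (m : Fin N.M) → N.ChannelMatrix m, N.slotProb ω = 1 := by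
  have := N.sum_slotProb_mul N.firstHop (fun _ => 1)
  simpa [N.sum_matrixProb] using this

theorem channelProb_nonneg {n : ℕ} (H : N.ChannelSeq n) : 0 ≤ N.channelProb H :=
  Finset.prod_nonneg fun t _ => N.slotProb_nonneg (H t)

theorem sum_channelProb (n : ℕ) : ∑ H : N.ChannelSeq n, N.channelProb H = 1 :=
  sum_iid_prod (P := N.slotProb) N.sum_slotProb

/-- Chebyshev's inequality for a function of the channel matrices of one hop. -/
theorem chebyshev_channelProb {n : ℕ} (m : Fin N.M) {g : N.ChannelMatrix m → ℝ} {μ V a : ℝ}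
    (hμ : ∑ A, N.matrixProb m A * g A = μ) (hV : ∑ A, N.matrixProb m A * (g A - μ) ^ 2 ≤ V)
    (ha : 0 < a) (S : Finset (Fin n)) (E : N.ChannelSeq n → Prop) [DecidablePred E]
    (hE : ∀ H, E H → a ≤ |∑ t ∈ S, g (H t m) - S.card * μ|) :
    ∑ H : N.ChannelSeq n, N.channelProb H * (if E H then 1 else 0) ≤ S.card * V / a ^ 2 :=
  chebyshev_iid (P := N.slotProb) N.slotProb_nonneg N.sum_slotProb (g := fun ω => g (ω m))
    (by rw [N.sum_slotProb_mul m g, hμ])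
    (by rw [N.sum_slotProb_mul m (fun A => (g A - μ) ^ 2)]; exact hV) ha S E hE

end RelayNetwork

/-! ### Converse: the cut-set bound -/

namespace RelayNetwork

variable {N : RelayNetwork}

namespace Code

variable {n : ℕ} {L : Fin (N.K 0) → ℕ} (c : N.Code n L)

theorem tx_succ (W : (k : Fin (N.K 0)) → Fin (L k)) (H : N.ChannelSeq n) (m : ℕ)
    (hm : m + 1 < N.M) (t : Fin n) (k : Fin (N.K (m + 1))) :
    c.tx W H (m + 1) hm t k = c.relay m hm k t
      (fun τ => c.rx W H ⟨m, Nat.lt_of_succ_lt hm⟩ τ.1 k) (N.csi H ⟨m + 1, hm⟩ t) := rfl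

/-- A relay sees only its own received symbols and the channels, so by induction on the layers the
messages act beyond hop `m` only through what that hop delivers. -/
theorem tx_congr_of_rx {W W' : (k : Fin (N.K 0)) → Fin (L k)} {H : N.ChannelSeq n} {m : Fin N.M}
    (h : c.rx W H m = c.rx W' H m) (m' : ℕ) (hm' : m' < N.M) (hlt : (m : ℕ) < m') :
    c.tx W H m' hm' = c.tx W' H m' hm' := by
  induction m' with
  | zero => omega
  | succ j ih =>
    have key : c.rx W H ⟨j, Nat.lt_of_succ_lt hm'⟩ = c.rx W' H ⟨j, Nat.lt_of_succ_lt hm'⟩ := by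
      rcases Nat.lt_succ_iff_lt_or_eq.1 hlt with h1 | h1
      · funext t
        simp only [rx]
        rw [ih (Nat.lt_of_succ_lt hm') h1]
      · obtain ⟨m, hm⟩ := m
        subst h1
        exact h
    funext t k
    rw [tx_succ, tx_succ, key]

theorem decoded_congr_of_rx {W W' : (k : Fin (N.K 0)) → Fin (L k)} {H : N.ChannelSeq n}
    {m : Fin N.M} (h : c.rx W H m = c.rx W' H m) (k : Fin (N.K 0)) :
    c.decoded W H k = c.decoded W' H k := by
  have key : c.rx W H N.lastHop = c.rx W' H N.lastHop := by
    rcases (show (m : ℕ) < N.M - 1 ∨ (m : ℕ) = N.M - 1 by omega) with h1 | h1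
    · funext t
      simp only [rx]
      rw [c.tx_congr_of_rx h (N.lastHop) N.lastHop.isLt h1]
    · rwa [show N.lastHop = m from Fin.ext h1.symm]
  simp only [decoded, key]

open Classical in
/-- Cut-set bound for one realization of the channels: the message tuples that are decoded
correctly are determined by the symbols received over any hop. -/
theorem card_correct_le (H : N.ChannelSeq n) (m : Fin N.M) :
    (Finset.univ.filter fun W : (k : Fin (N.K 0)) → Fin (L k) =>
      ∀ k, c.decoded W H k = W k).card ≤ 2 ^ ∑ t, (H t m).rank := by
  have hcard : Fintype.card ((t : Fin n) → LinearMap.range (H t m).mulVecLin)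
      = 2 ^ ∑ t, (H t m).rank := by
    rw [Fintype.card_pi, ← Finset.prod_pow_eq_pow_sum]
    refine Finset.prod_congr rfl fun t _ => ?_
    rw [Module.card_eq_pow_finrank (K := ZMod 2), ZMod.card]
    rfl
  rw [← hcard, ← Finset.card_univ]
  refine Finset.card_le_card_of_injOn
    (fun W t => ⟨c.rx W H m t, ⟨c.tx W H m m.isLt t, rfl⟩⟩)
    (fun _ _ => Finset.mem_coe.2 (Finset.mem_univ _)) ?_
  intro W hW W' hW' hEq
  have hrx : c.rx W H m = c.rx W' H m := by
    funext t
    exact congrArg Subtype.val (congrFun hEq t)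
  funext k
  have h1 : c.decoded W H k = W k := (Finset.mem_filter.1 (Finset.mem_coe.1 hW)).2 k
  have h2 : c.decoded W' H k = W' k := (Finset.mem_filter.1 (Finset.mem_coe.1 hW')).2 k
  rw [← h1, ← h2, c.decoded_congr_of_rx hrx]

theorem sum_inv_card (hL : ∀ k, 0 < L k) :
    ∑ _W : (k : Fin (N.K 0)) → Fin (L k), (∏ i, (L i : ℝ)⁻¹) = 1 := by
  rw [Finset.sum_const, Finset.card_univ, Fintype.card_pi, nsmul_eq_mul]
  simp only [Fintype.card_fin, Nat.cast_prod]
  rw [← Finset.prod_mul_distrib]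
  exact Finset.prod_eq_one fun k _ => mul_inv_cancel₀ (by exact_mod_cast (hL k).ne')

-- Union bound over the destinations, applied pointwise in the messages and the channels.
open Classical in
theorem one_sub_sum_errorProb_le (hL : ∀ k, 0 < L k) :
    1 - ∑ k, c.errorProb k ≤ ∑ H : N.ChannelSeq n, N.channelProb H *
      ((∏ i, (L i : ℝ)⁻¹) * (Finset.univ.filter fun W : (k : Fin (N.K 0)) → Fin (L k) =>
        ∀ k, c.decoded W H k = W k).card) := by
  have h1 : ∑ H : N.ChannelSeq n, ∑ _W : (k : Fin (N.K 0)) → Fin (L k),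
      (∏ i, (L i : ℝ)⁻¹) * N.channelProb H = 1 := by
    simp_rw [← Finset.sum_mul, sum_inv_card hL, one_mul]
    exact N.sum_channelProb n
  have h2 : ∑ k, c.errorProb k = ∑ H : N.ChannelSeq n, ∑ W : (k : Fin (N.K 0)) → Fin (L k),
      (∏ i, (L i : ℝ)⁻¹) * N.channelProb H *
        ∑ k, (if c.decoded W H k ≠ W k then (1 : ℝ) else 0) := by
    simp only [errorProb]
    rw [Finset.sum_comm, Finset.sum_comm (s := (Finset.univ : Finset (N.ChannelSeq n)))]
    refine Finset.sum_congr rfl fun W _ => ?_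
    rw [Finset.sum_comm]
    simp_rw [Finset.mul_sum]
  rw [← h1, h2, ← Finset.sum_sub_distrib]
  refine Finset.sum_le_sum fun H _ => ?_
  rw [← Finset.sum_sub_distrib, Finset.card_filter, Nat.cast_sum, Finset.mul_sum, Finset.mul_sum]
  refine Finset.sum_le_sum fun W _ => ?_
  have hnn : 0 ≤ (∏ i, (L i : ℝ)⁻¹) * N.channelProb H :=
    mul_nonneg (Finset.prod_nonneg fun _ _ => by positivity) (N.channelProb_nonneg H)
  have hle : 1 - ∑ k, (if c.decoded W H k ≠ W k then (1 : ℝ) else 0)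
      ≤ ((if ∀ k, c.decoded W H k = W k then 1 else 0 : ℕ) : ℝ) := by
    by_cases hW : ∀ k, c.decoded W H k = W k
    · simp [hW]
    · rw [if_neg hW]
      push Not at hW
      obtain ⟨k, hk⟩ := hW
      have := Finset.single_le_sum (f := fun k => if c.decoded W H k ≠ W k then (1 : ℝ) else 0)
        (fun i _ => by positivity) (Finset.mem_univ k)
      simp only [ne_eq, hk, not_false_eq_true, if_true] at this
      simp only [ne_eq, Nat.cast_zero]
      linarith
  calc _ = (∏ i, (L i : ℝ)⁻¹) * N.channelProb H *
        (1 - ∑ k, (if c.decoded W H k ≠ W k then (1 : ℝ) else 0)) := by ring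
    _ ≤ _ := mul_le_mul_of_nonneg_left hle hnn
    _ = _ := by ring

end Code

theorem numMessages_pos (n : ℕ) (r : ℝ) : 0 < numMessages n r :=
  Nat.ceil_pos.2 (by positivity)

theorem le_numMessages (n : ℕ) (r : ℝ) : (2 : ℝ) ^ ((n : ℝ) * r) ≤ numMessages n r :=
  Nat.le_ceil _

theorem prod_inv_numMessages_le (n : ℕ) {ι : Type*} [Fintype ι] (R : ι → ℝ) :
    ∏ i, (numMessages n (R i) : ℝ)⁻¹ ≤ (2 : ℝ) ^ (-(n * ∑ i, R i)) := by
  rw [Finset.mul_sum, ← Finset.sum_neg_distrib, Real.rpow_sum_of_pos two_pos]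
  refine Finset.prod_le_prod (fun _ _ => by positivity) fun i _ => ?_
  rw [Real.rpow_neg two_pos.le]
  exact inv_anti₀ (by positivity) (le_numMessages n _)

/-- Every achievable sum rate is at most the average rank of any hop. -/
theorem Achievable.sum_le_avgRank {R : Fin (N.K 0) → ℝ} (hR : N.Achievable R) (m : Fin N.M) :
    ∑ k, R k ≤ N.avgRank m := by
  classical
  obtain ⟨-, c, hc⟩ := hR
  by_contra! hlt
  set ρ := N.avgRank m
  -- With half the gap as margin, the rank sum exceeds `n (ρ + δ)` with probability `O(1/n)`.
  -- Otherwise at most `2 ^ (n (ρ + δ))` of at least `2 ^ (n (ρ + 2 δ))` tuples are decoded, a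
  -- fraction `2 ^ (-n δ)`.
  set δ := (∑ k, R k - ρ) / 2 with hδ
  have hδ0 : 0 < δ := by rw [hδ]; linarith
  set V := ∑ A, N.matrixProb m A * ((A.rank : ℝ) - ρ) ^ 2
  have hbound : ∀ n : ℕ, 0 < n → 1 - ∑ k, (c n).errorProb k
      ≤ V / δ ^ 2 * (1 / (n : ℝ)) + ((2 : ℝ) ^ (-δ)) ^ n := by
    intro n hn
    have hn' : (0 : ℝ) < n := by exact_mod_cast hn
    have hch := N.chebyshev_channelProb (n := n) m (g := fun A => (A.rank : ℝ)) (μ := ρ) (V := V)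
      (a := n * δ) rfl le_rfl (by positivity) Finset.univ
      (fun H => n * (ρ + δ) ≤ ∑ t, ((H t m).rank : ℝ)) (by
        intro H hH
        refine le_trans ?_ (le_abs_self _)
        simp only [Finset.card_univ, Fintype.card_fin]
        linarith)
    refine ((c n).one_sub_sum_errorProb_le (fun k => numMessages_pos _ _)).trans ?_
    have hpt : ∀ H : N.ChannelSeq n, N.channelProb H *
        ((∏ i, (numMessages n (R i) : ℝ)⁻¹) *
          (Finset.univ.filter fun W : (k : Fin (N.K 0)) → Fin (numMessages n (R k)) =>
            ∀ k, (c n).decoded W H k = W k).card)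
        ≤ N.channelProb H * (if n * (ρ + δ) ≤ ∑ t, ((H t m).rank : ℝ) then 1 else 0)
          + N.channelProb H * ((2 : ℝ) ^ (-δ)) ^ n := by
      intro H
      rw [← mul_add]
      refine mul_le_mul_of_nonneg_left ?_ (N.channelProb_nonneg H)
      have hpn : 0 ≤ ∏ i, (numMessages n (R i) : ℝ)⁻¹ :=
        Finset.prod_nonneg fun _ _ => by positivity
      have h2 : 0 ≤ ((2 : ℝ) ^ (-δ)) ^ n := by positivity
      split_ifs with h
      · refine le_trans ?_ (le_add_of_nonneg_right h2)
        have h3 := Code.sum_inv_card (N := N) (L := fun k => numMessages n (R k))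
          (fun k => numMessages_pos _ _)
        rw [Finset.sum_const, nsmul_eq_mul, mul_comm] at h3
        rw [← h3]
        refine mul_le_mul_of_nonneg_left ?_ hpn
        exact_mod_cast Finset.card_filter_le _ _
      · push Not at h
        rw [zero_add]
        have h4 : ((Finset.univ.filter fun W : (k : Fin (N.K 0)) → Fin (numMessages n (R k)) =>
            ∀ k, (c n).decoded W H k = W k).card : ℝ) ≤ (2 : ℝ) ^ (n * (ρ + δ)) := by
          refine le_trans (b := (2 : ℝ) ^ (∑ t, ((H t m).rank : ℝ))) ?_
            (Real.rpow_le_rpow_of_exponent_le one_le_two h.le)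
          rw [← Nat.cast_sum, Real.rpow_natCast]
          exact_mod_cast (c n).card_correct_le H m
        calc _ ≤ (2 : ℝ) ^ (-(n * ∑ i, R i)) * (2 : ℝ) ^ (n * (ρ + δ)) :=
              mul_le_mul (prod_inv_numMessages_le n R) h4 (by positivity) (by positivity)
          _ = _ := by
              rw [← Real.rpow_add two_pos, ← Real.rpow_natCast, ← Real.rpow_mul two_pos.le]
              congr 1
              rw [hδ]; ring
    refine (Finset.sum_le_sum fun H _ => hpt H).trans ?_
    rw [Finset.sum_add_distrib, ← Finset.sum_mul, N.sum_channelProb, one_mul]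
    refine add_le_add (hch.trans (le_of_eq ?_)) le_rfl
    simp only [Finset.card_univ, Fintype.card_fin]
    field_simp
  have hl : Tendsto (fun n => 1 - ∑ k, (c n).errorProb k) atTop (𝓝 (1 - ∑ _k : Fin (N.K 0), 0)) :=
    tendsto_const_nhds.sub (tendsto_finsetSum _ fun k _ => hc k)
  have hr : Tendsto (fun n : ℕ => V / δ ^ 2 * (1 / (n : ℝ)) + ((2 : ℝ) ^ (-δ)) ^ n) atTop
      (𝓝 (V / δ ^ 2 * 0 + 0)) :=
    (tendsto_const_nhds.mul tendsto_one_div_atTop_nhds_zero_nat).add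
      (tendsto_pow_atTop_nhds_zero_of_lt_one (by positivity)
        (Real.rpow_lt_one_of_one_lt_of_neg one_lt_two (by linarith)))
  have := le_of_tendsto_of_tendsto hl hr
    (by filter_upwards [eventually_gt_atTop 0] with n hn using hbound n hn)
  simp at this
  linarith

end RelayNetwork

/-! ### Pivot blocks of matrices of given rank -/

namespace Matrix

variable {F : Type*} [Field F] {b a r : ℕ}

/-- The coordinates `f` are independent on the subspace `C`. -/
def IndepCoords (C : Submodule F (Fin b → F)) (f : Fin r ↪ Fin b) : Prop :=
  ∀ c : Fin r → F, (∀ y ∈ C, ∑ i, c i * y (f i) = 0) → c = 0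

theorem vecMul_submatrix_eq_zero (B : Matrix (Fin b) (Fin a) F) (f : Fin r ↪ Fin b)
    (hf : IndepCoords (LinearMap.range B.mulVecLin) f) (c : Fin r → F)
    (hc : c ᵥ* B.submatrix f id = 0) : c = 0 := by
  refine hf c ?_
  rintro _ ⟨x, rfl⟩
  have h : c ⬝ᵥ (B.submatrix f id *ᵥ x) = 0 := by
    rw [dotProduct_mulVec, hc, zero_dotProduct]
  exact h

theorem linearIndependent_row_submatrix (B : Matrix (Fin b) (Fin a) F) (f : Fin r ↪ Fin b)
    (hf : IndepCoords (LinearMap.range B.mulVecLin) f) :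
    LinearIndependent F (B.submatrix f id).row := by
  rw [← vecMul_injective_iff]
  intro c d h
  rw [← sub_eq_zero]
  refine vecMul_submatrix_eq_zero B f hf _ ?_
  rw [sub_vecMul]
  exact sub_eq_zero.2 h

/-- Take rows forming a basis of the row space. A relation among these coordinates on the column
space, tested on the columns of `B`, is a linear relation among the rows. -/
theorem exists_indepCoords (B : Matrix (Fin b) (Fin a) F) (hB : B.rank = r) :
    ∃ f : Fin r ↪ Fin b, IndepCoords (LinearMap.range B.mulVecLin) f := by
  rw [rank_eq_finrank_span_row] at hB
  subst hB
  obtain ⟨v, hv, -, hli⟩ := Submodule.exists_fun_fin_finrank_span_eq F (Set.range B.row)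
  choose g hg using hv
  have hinj : Function.Injective g := fun i j hij => hli.injective (by rw [← hg, ← hg, hij])
  refine ⟨⟨g, hinj⟩, fun c hc => ?_⟩
  rw [Fintype.linearIndependent_iff] at hli
  refine funext (hli c ?_)
  funext x
  classical
  have := hc _ ⟨Pi.single x 1, rfl⟩
  have hgx : ∀ i, B (g i) x = v i x := fun i => congrFun (hg i) x
  simpa [Matrix.col, hgx] using this

/-- With `r = rank B`, the rows of `B` are combinations of `r` independent rows. -/
theorem exists_eq_mul_submatrix (B : Matrix (Fin b) (Fin a) F) (hB : B.rank = r)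
    (f : Fin r ↪ Fin b) (hf : IndepCoords (LinearMap.range B.mulVecLin) f) :
    ∃ Y : Matrix (Fin b) (Fin r) F, B = Y * B.submatrix f id := by
  have hrk := (linearIndependent_row_submatrix B f hf).rank_matrix
  rw [Fintype.card_fin, rank_eq_finrank_span_row] at hrk
  rw [rank_eq_finrank_span_row] at hB
  have hspan : Submodule.span F (Set.range (B.submatrix f id).row)
      = Submodule.span F (Set.range B.row) := by
    refine Submodule.eq_of_le_of_finrank_eq (Submodule.span_mono ?_) (hrk.trans hB.symm)
    rintro _ ⟨i, rfl⟩
    exact ⟨f i, rfl⟩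
  have hmem : ∀ i, ∃ c : Fin r → F, ∑ j, c j • (B.submatrix f id).row j = B.row i := by
    intro i
    rw [← Submodule.mem_span_range_iff_exists_fun, hspan]
    exact Submodule.subset_span ⟨i, rfl⟩
  choose Y hY using hmem
  refine ⟨of Y, ?_⟩
  ext i j
  have := congrFun (hY i) j
  simp only [Finset.sum_apply, Pi.smul_apply, smul_eq_mul] at this
  rw [mul_apply]
  exact this.symm

/-- All rows are combinations of the pivot rows, so a vector killed by the pivot block is killed by
all of the pivot columns. It is then a relation among the coordinates `e` on the row space, hence
zero. -/
theorem isUnit_submatrix (B : Matrix (Fin b) (Fin a) F) (hB : B.rank = r)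
    (f : Fin r ↪ Fin b) (hf : IndepCoords (LinearMap.range B.mulVecLin) f)
    (e : Fin r ↪ Fin a) (he : IndepCoords (LinearMap.range Bᵀ.mulVecLin) e) :
    IsUnit (B.submatrix f e) := by
  obtain ⟨Y, hY⟩ := exists_eq_mul_submatrix B hB f hf
  rw [← mulVec_injective_iff_isUnit]
  intro c d h
  rw [← sub_eq_zero]
  refine he _ ?_
  have h0 : B.submatrix f e *ᵥ (c - d) = 0 := by rw [mulVec_sub]; exact sub_eq_zero.2 h
  rintro _ ⟨x, rfl⟩
  have hBe : B.submatrix id e = Y * B.submatrix f e := by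
    conv_lhs => rw [hY]
    rfl
  have h1 : x ⬝ᵥ (B.submatrix id e *ᵥ (c - d)) = 0 := by
    rw [hBe, ← mulVec_mulVec, h0, mulVec_zero, dotProduct_zero]
  rw [← h1, dotProduct_mulVec, dotProduct_comm]
  refine Finset.sum_congr rfl fun i _ => ?_
  congr 1
  simp [vecMul, dotProduct]

/-- In `B = Y * (pivot rows)`, restriction to the columns `e` gives `Y * A`, which determines `Y`.
-/
theorem eq_mul_inv_mul (B : Matrix (Fin b) (Fin a) F) (hB : B.rank = r)
    (f : Fin r ↪ Fin b) (hf : IndepCoords (LinearMap.range B.mulVecLin) f)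
    (e : Fin r ↪ Fin a) (A : (Matrix (Fin r) (Fin r) F)ˣ) (hA : B.submatrix f e = A) :
    B = B.submatrix id e * ((A⁻¹ : (Matrix (Fin r) (Fin r) F)ˣ) : Matrix (Fin r) (Fin r) F) *
      B.submatrix f id := by
  obtain ⟨Y, hY⟩ := exists_eq_mul_submatrix B hB f hf
  have hBe : B.submatrix id e = Y * (A : Matrix (Fin r) (Fin r) F) := by
    rw [← hA]
    conv_lhs => rw [hY]
    rfl
  rw [hBe, Matrix.mul_assoc Y, Units.mul_inv, Matrix.mul_one]
  exact hY

/-- Coordinates that are independent on `C`, chosen from `C` alone. -/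
noncomputable def coords (hr : r ≤ b) (C : Submodule F (Fin b → F)) : Fin r ↪ Fin b :=
  open Classical in
  if h : ∃ f : Fin r ↪ Fin b, IndepCoords C f then h.choose else Fin.castLEEmb hr

theorem indepCoords_coords (hr : r ≤ b) (B : Matrix (Fin b) (Fin a) F) (hB : B.rank = r) :
    IndepCoords (LinearMap.range B.mulVecLin) (coords hr (LinearMap.range B.mulVecLin)) := by
  have h := exists_indepCoords B hB
  rw [coords, dif_pos h]
  exact h.choose_spec

variable (ha : r ≤ a) (hb : r ≤ b)

/-- The pivot rows of a matrix of rank `r`. -/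
noncomputable def pivotRows (B : Matrix (Fin b) (Fin a) F) : Fin r ↪ Fin b :=
  coords hb (LinearMap.range B.mulVecLin)

/-- The pivot columns of a matrix of rank `r`. -/
noncomputable def pivotCols (B : Matrix (Fin b) (Fin a) F) : Fin r ↪ Fin a :=
  coords ha (LinearMap.range Bᵀ.mulVecLin)

/-- The submatrix of the pivot rows and columns. -/
noncomputable def pivotBlock (B : Matrix (Fin b) (Fin a) F) : Matrix (Fin r) (Fin r) F :=
  B.submatrix (pivotRows hb B) (pivotCols ha B)

theorem isUnit_pivotBlock (B : Matrix (Fin b) (Fin a) F) (hB : B.rank = r) :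
    IsUnit (pivotBlock ha hb B) :=
  isUnit_submatrix B hB _ (indepCoords_coords hb B hB) _
    (indepCoords_coords ha Bᵀ (by rw [rank_transpose, hB]))

/-- Replacement of the pivot block `A` of a matrix by `A'`, which keeps the row space and the
column space. -/
noncomputable def changePivotBlock (A A' : (Matrix (Fin r) (Fin r) F)ˣ)
    (B : Matrix (Fin b) (Fin a) F) : Matrix (Fin b) (Fin a) F :=
  B.submatrix id (pivotCols ha B) * ((A⁻¹ * A' * A⁻¹ : (Matrix (Fin r) (Fin r) F)ˣ) :
    Matrix (Fin r) (Fin r) F) * B.submatrix (pivotRows hb B) id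

theorem range_mulVecLin_mul_le {l m n : Type*} [Fintype m] [Fintype n]
    (A : Matrix l m F) (B : Matrix m n F) :
    LinearMap.range (A * B).mulVecLin ≤ LinearMap.range A.mulVecLin := by
  rw [mulVecLin_mul]
  exact LinearMap.range_comp_le_range _ _

theorem range_submatrix_id_le (B : Matrix (Fin b) (Fin a) F) (e : Fin r ↪ Fin a) :
    LinearMap.range (B.submatrix id e).mulVecLin ≤ LinearMap.range B.mulVecLin := by
  rw [range_mulVecLin, range_mulVecLin]
  refine Submodule.span_mono ?_
  rintro _ ⟨i, rfl⟩
  exact ⟨e i, rfl⟩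

section

variable {A : (Matrix (Fin r) (Fin r) F)ˣ} (A' : (Matrix (Fin r) (Fin r) F)ˣ)
  {B : Matrix (Fin b) (Fin a) F}

/-- The middle factor `A⁻¹` of the factorization of `B` has become `A⁻¹ A' A⁻¹`. Restriction to the
pivot columns multiplies it on the right by `A`, restriction to the pivot rows on the left, so the
new pivot block is `A A⁻¹ A' A⁻¹ A = A'`. -/
theorem changePivotBlock_submatrix_cols (hA : pivotBlock ha hb B = A) :
    (changePivotBlock ha hb A A' B).submatrix id (pivotCols ha B)
      = B.submatrix id (pivotCols ha B) * ((A⁻¹ * A' : (Matrix (Fin r) (Fin r) F)ˣ) :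
        Matrix (Fin r) (Fin r) F) := by
  have : (changePivotBlock ha hb A A' B).submatrix id (pivotCols ha B)
      = B.submatrix id (pivotCols ha B) * ((A⁻¹ * A' * A⁻¹ : (Matrix (Fin r) (Fin r) F)ˣ) :
        Matrix (Fin r) (Fin r) F) * pivotBlock ha hb B := rfl
  rw [this, hA, Matrix.mul_assoc, ← Units.val_mul, inv_mul_cancel_right]

theorem changePivotBlock_submatrix_rows (hA : pivotBlock ha hb B = A) :
    (changePivotBlock ha hb A A' B).submatrix (pivotRows hb B) id
      = ((A' * A⁻¹ : (Matrix (Fin r) (Fin r) F)ˣ) : Matrix (Fin r) (Fin r) F) *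
        B.submatrix (pivotRows hb B) id := by
  have : (changePivotBlock ha hb A A' B).submatrix (pivotRows hb B) id
      = pivotBlock ha hb B * ((A⁻¹ * A' * A⁻¹ : (Matrix (Fin r) (Fin r) F)ˣ) :
        Matrix (Fin r) (Fin r) F) * B.submatrix (pivotRows hb B) id := rfl
  rw [this, hA, ← Units.val_mul, mul_assoc A⁻¹, mul_inv_cancel_left]

theorem changePivotBlock_submatrix (hA : pivotBlock ha hb B = A) :
    (changePivotBlock ha hb A A' B).submatrix (pivotRows hb B) (pivotCols ha B) = A' := by
  have h := congrArg (fun X => X.submatrix (pivotRows hb B) id)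
    (changePivotBlock_submatrix_cols ha hb A' hA)
  have h2 : (changePivotBlock ha hb A A' B).submatrix (pivotRows hb B) (pivotCols ha B)
      = pivotBlock ha hb B * ((A⁻¹ * A' : (Matrix (Fin r) (Fin r) F)ˣ) :
        Matrix (Fin r) (Fin r) F) := h
  rw [h2, hA, ← Units.val_mul, mul_inv_cancel_left]

/-- The factors combine to `A⁻¹ A' · A'⁻¹ A A'⁻¹ · A' A⁻¹ = A⁻¹`. This yields both the inverse map
and the reverse inclusions of the row and column spaces. -/
theorem changePivotBlock_back (hB : B.rank = r) (hA : pivotBlock ha hb B = A) :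
    (changePivotBlock ha hb A A' B).submatrix id (pivotCols ha B) *
      ((A'⁻¹ * A * A'⁻¹ : (Matrix (Fin r) (Fin r) F)ˣ) : Matrix (Fin r) (Fin r) F) *
      (changePivotBlock ha hb A A' B).submatrix (pivotRows hb B) id = B := by
  rw [changePivotBlock_submatrix_cols ha hb A' hA, changePivotBlock_submatrix_rows ha hb A' hA]
  conv_rhs => rw [eq_mul_inv_mul B hB _ (indepCoords_coords hb B hB) _ A hA]
  rw [Matrix.mul_assoc (B.submatrix id _), ← Units.val_mul, ← Matrix.mul_assoc _ _ (B.submatrix _ id),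
    Matrix.mul_assoc (B.submatrix id _), ← Units.val_mul]
  congr 3
  group

theorem range_changePivotBlock (hB : B.rank = r) (hA : pivotBlock ha hb B = A) :
    LinearMap.range (changePivotBlock ha hb A A' B).mulVecLin = LinearMap.range B.mulVecLin := by
  refine le_antisymm ?_ ?_
  · rw [changePivotBlock, Matrix.mul_assoc]
    exact (range_mulVecLin_mul_le _ _).trans (range_submatrix_id_le _ _)
  · conv_lhs => rw [← changePivotBlock_back ha hb A' hB hA, Matrix.mul_assoc]
    exact (range_mulVecLin_mul_le _ _).trans (range_submatrix_id_le _ _)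

theorem range_changePivotBlock_transpose (hB : B.rank = r) (hA : pivotBlock ha hb B = A) :
    LinearMap.range (changePivotBlock ha hb A A' B)ᵀ.mulVecLin
      = LinearMap.range Bᵀ.mulVecLin := by
  refine le_antisymm ?_ ?_
  · rw [changePivotBlock, transpose_mul, transpose_submatrix]
    exact (range_mulVecLin_mul_le _ _).trans (range_submatrix_id_le _ _)
  · conv_lhs => rw [← changePivotBlock_back ha hb A' hB hA, transpose_mul, transpose_submatrix]
    exact (range_mulVecLin_mul_le _ _).trans (range_submatrix_id_le _ _)

/-- Pivots depend only on the row and column spaces, which the change of block preserves; this is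
the reason for choosing them by `coords`. -/
theorem pivotRows_changePivotBlock (hB : B.rank = r) (hA : pivotBlock ha hb B = A) :
    pivotRows hb (changePivotBlock ha hb A A' B) = (pivotRows hb B : Fin r ↪ Fin b) := by
  rw [pivotRows, range_changePivotBlock ha hb A' hB hA, pivotRows]

theorem pivotCols_changePivotBlock (hB : B.rank = r) (hA : pivotBlock ha hb B = A) :
    pivotCols ha (changePivotBlock ha hb A A' B) = (pivotCols ha B : Fin r ↪ Fin a) := by
  rw [pivotCols, range_changePivotBlock_transpose ha hb A' hB hA, pivotCols]

theorem changePivotBlock_changePivotBlock (hB : B.rank = r) (hA : pivotBlock ha hb B = A) :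
    changePivotBlock ha hb A' A (changePivotBlock ha hb A A' B) = B := by
  conv_rhs => rw [← changePivotBlock_back ha hb A' hB hA]
  rw [changePivotBlock, pivotRows_changePivotBlock ha hb A' hB hA,
    pivotCols_changePivotBlock ha hb A' hB hA]

theorem rank_changePivotBlock (hB : B.rank = r) (hA : pivotBlock ha hb B = A) :
    (changePivotBlock ha hb A A' B).rank = r := by
  rw [rank, range_changePivotBlock ha hb A' hB hA, ← hB, rank]

theorem pivotBlock_changePivotBlock (hB : B.rank = r) (hA : pivotBlock ha hb B = A) :
    pivotBlock ha hb (changePivotBlock ha hb A A' B) = A' := by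
  rw [pivotBlock, pivotRows_changePivotBlock ha hb A' hB hA,
    pivotCols_changePivotBlock ha hb A' hB hA]
  exact changePivotBlock_submatrix ha hb A' hA

end

open Classical in
/-- Among the matrices of rank `r`, all invertible pivot blocks are equally frequent. -/
theorem card_pivotBlock_eq [Fintype F] (A A' : (Matrix (Fin r) (Fin r) F)ˣ) :
    (Finset.univ.filter fun B : Matrix (Fin b) (Fin a) F =>
      B.rank = r ∧ pivotBlock ha hb B = A).card =
    (Finset.univ.filter fun B : Matrix (Fin b) (Fin a) F =>
      B.rank = r ∧ pivotBlock ha hb B = A').card := by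
  refine Finset.card_bij' (fun B _ => changePivotBlock ha hb A A' B)
    (fun B _ => changePivotBlock ha hb A' A B) ?_ ?_ ?_ ?_
  · intro B hB
    obtain ⟨h1, h2⟩ := (Finset.mem_filter.1 hB).2
    exact Finset.mem_filter.2 ⟨Finset.mem_univ _, rank_changePivotBlock ha hb A' h1 h2,
      pivotBlock_changePivotBlock ha hb A' h1 h2⟩
  · intro B hB
    obtain ⟨h1, h2⟩ := (Finset.mem_filter.1 hB).2
    exact Finset.mem_filter.2 ⟨Finset.mem_univ _, rank_changePivotBlock ha hb A h1 h2,
      pivotBlock_changePivotBlock ha hb A h1 h2⟩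
  · intro B hB
    obtain ⟨h1, h2⟩ := (Finset.mem_filter.1 hB).2
    exact changePivotBlock_changePivotBlock ha hb A' h1 h2
  · intro B hB
    obtain ⟨h1, h2⟩ := (Finset.mem_filter.1 hB).2
    exact changePivotBlock_changePivotBlock ha hb A h1 h2

end Matrix

/-! ### Coupling channel matrices with uniform pairs of frames -/

/-- An ordered choice of `r` among `K` nodes, with a basis of `𝔽₂ ^ r`. -/
abbrev Frame (r K : ℕ) : Type := (Fin r ↪ Fin K) × (Matrix (Fin r) (Fin r) (ZMod 2))ˣ

/-- The probability that a uniform `b × a` matrix over the binary field has rank `r`. -/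
noncomputable def rankProb (b a r : ℕ) : ℝ :=
  ((2 : ℝ) ^ (b * a))⁻¹ *
    ∑ B : Matrix (Fin b) (Fin a) (ZMod 2), if B.rank = r then 1 else 0

theorem rankProb_nonneg (b a r : ℕ) : 0 ≤ rankProb b a r :=
  mul_nonneg (by positivity) (Finset.sum_nonneg fun _ _ => by positivity)

theorem rankProb_comm (b a r : ℕ) : rankProb b a r = rankProb a b r := by
  rw [rankProb, rankProb, mul_comm b a]
  congr 1
  refine Fintype.sum_equiv (transposeAddEquiv _ _ _).toEquiv _ _ fun B => ?_
  change _ = if Bᵀ.rank = r then (1 : ℝ) else 0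
  rw [rank_transpose]

theorem card_matrix_zmod_two (m n : ℕ) :
    Fintype.card (Matrix (Fin m) (Fin n) (ZMod 2)) = 2 ^ (m * n) := by
  change Fintype.card (Fin m → Fin n → ZMod 2) = _
  simp [pow_mul, mul_comm m n]

/-- The symmetric group is transitive on embeddings, so `σ ↦ ρ σ π` matches the two sets. Hence a
random relabelling sends any given pivots to uniformly distributed nodes. -/
theorem card_perm_comp_eq {r K : ℕ} (x e x' e' : Fin r ↪ Fin K) :
    (Finset.univ.filter fun σ : Equiv.Perm (Fin K) => x.trans σ.toEmbedding = e).card =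
    (Finset.univ.filter fun σ : Equiv.Perm (Fin K) => x'.trans σ.toEmbedding = e').card := by
  obtain ⟨ρ, hρ⟩ := (Equiv.Perm.isMultiplyPretransitive (Fin K) r).exists_smul_eq e e'
  obtain ⟨π, hπ⟩ := (Equiv.Perm.isMultiplyPretransitive (Fin K) r).exists_smul_eq x' x
  have hρ' : ∀ i, ρ (e i) = e' i := fun i => DFunLike.congr_fun hρ i
  have hπ' : ∀ i, π (x' i) = x i := fun i => DFunLike.congr_fun hπ i
  refine Finset.card_equiv ((Equiv.mulLeft ρ).trans (Equiv.mulRight π)) fun σ => ?_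
  simp only [Finset.mem_filter, Finset.mem_univ, true_and, DFunLike.ext_iff,
    Function.Embedding.trans_apply, Equiv.coe_toEmbedding, Equiv.trans_apply, Equiv.coe_mulLeft,
    Equiv.coe_mulRight, Equiv.Perm.mul_apply, hπ', ← hρ', ρ.apply_eq_iff_eq]

section

variable {a b K K' : ℕ} (ha : a ≤ K) (hb : b ≤ K')

/-- The upper left corner of a matrix. -/
def corner (G : Matrix (Fin K') (Fin K) (ZMod 2)) : Matrix (Fin b) (Fin a) (ZMod 2) :=
  G.submatrix (Fin.castLE hb) (Fin.castLE ha)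

/-- The corner of a uniform matrix is uniform. -/
theorem sum_corner (g : Matrix (Fin b) (Fin a) (ZMod 2) → ℝ) :
    ((2 : ℝ) ^ (K' * K))⁻¹ * ∑ G, g (corner ha hb G) = ((2 : ℝ) ^ (b * a))⁻¹ * ∑ B, g B := by
  classical
  let φ : Matrix (Fin K') (Fin K) (ZMod 2) →+ Matrix (Fin b) (Fin a) (ZMod 2) :=
    { toFun := corner ha hb, map_zero' := rfl, map_add' := fun _ _ => rfl }
  have hsurj : Function.Surjective φ := by
    intro B
    refine ⟨fun i j => if h : (i : ℕ) < b ∧ (j : ℕ) < a then B ⟨i, h.1⟩ ⟨j, h.2⟩ else 0, ?_⟩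
    ext i j
    change (if h : (i : ℕ) < b ∧ (j : ℕ) < a then B ⟨i, h.1⟩ ⟨j, h.2⟩ else 0) = B i j
    simp
  -- Taking the corner is a surjective additive homomorphism, so its fibres have equal size; the
  -- case `g = 1` below determines that size.
  have hfib : ∀ B, (Finset.univ.filter fun G => φ G = B).card
      = (Finset.univ.filter fun G => φ G = 0).card := fun B =>
    AddMonoidHom.card_fiber_eq_of_mem_range φ (hsurj B) (hsurj 0)
  set k := (Finset.univ.filter fun G => φ G = 0).card
  have key : ∀ g : Matrix (Fin b) (Fin a) (ZMod 2) → ℝ,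
      ∑ G, g (corner ha hb G) = k * ∑ B, g B := by
    intro g
    rw [← Finset.sum_fiberwise Finset.univ φ, Finset.mul_sum]
    refine Finset.sum_congr rfl fun B _ => ?_
    rw [← hfib B, ← nsmul_eq_mul]
    refine Finset.sum_eq_card_nsmul fun G hG => ?_
    rw [← (Finset.mem_filter.1 hG).2]
    rfl
  have h1 := key fun _ => 1
  simp only [Finset.sum_const, Finset.card_univ, nsmul_eq_mul, mul_one] at h1
  rw [card_matrix_zmod_two, card_matrix_zmod_two] at h1
  simp only [Nat.cast_pow, Nat.cast_ofNat] at h1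
  rw [key, h1]
  have hk : (k : ℝ) ≠ 0 := by
    intro h
    rw [h, zero_mul] at h1
    exact absurd h1 (by positivity)
  field_simp

variable {r : ℕ} (hra : r ≤ a) (hrb : r ≤ b)

open Classical in
/-- The pivot block of the corner of `G` maps the basis of `F` to that of `F'`, and the
permutations take its columns and rows to the nodes of `F` and `F'`. -/
noncomputable def pivotInd (F : Frame r K) (F' : Frame r K') (G : Matrix (Fin K') (Fin K) (ZMod 2))
    (σ : Equiv.Perm (Fin K)) (τ : Equiv.Perm (Fin K')) : ℝ :=
  (if (corner ha hb G).rank = r ∧ pivotBlock hra hrb (corner ha hb G) * F.2 = F'.2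
    then 1 else 0) *
  ((if ((pivotCols hra (corner ha hb G)).trans (Fin.castLEEmb ha)).trans σ.toEmbedding = F.1
    then 1 else 0) *
  (if ((pivotRows hrb (corner ha hb G)).trans (Fin.castLEEmb hb)).trans τ.toEmbedding = F'.1
    then 1 else 0))

open Classical in
/-- The joint weight of a matrix and of two frames that it connects, when the nodes on both sides
are randomly relabelled before the pivots are chosen. -/
noncomputable def coupling (G : Matrix (Fin K') (Fin K) (ZMod 2)) (F : Frame r K)
    (F' : Frame r K') : ℝ :=
  ((2 : ℝ) ^ (K' * K) * (K.factorial * K'.factorial) *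
      Fintype.card (Matrix (Fin r) (Fin r) (ZMod 2))ˣ)⁻¹ *
    ∑ G', ∑ σ : Equiv.Perm (Fin K), ∑ τ : Equiv.Perm (Fin K'),
      pivotInd ha hb hra hrb F F' G' σ τ * if G'.submatrix τ.symm σ.symm = G then 1 else 0

theorem pivotInd_nonneg (F : Frame r K) (F' : Frame r K') (G : Matrix (Fin K') (Fin K) (ZMod 2))
    (σ : Equiv.Perm (Fin K)) (τ : Equiv.Perm (Fin K')) :
    0 ≤ pivotInd ha hb hra hrb F F' G σ τ := by
  unfold pivotInd; positivity

theorem coupling_nonneg (G : Matrix (Fin K') (Fin K) (ZMod 2)) (F : Frame r K)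
    (F' : Frame r K') : 0 ≤ coupling ha hb hra hrb G F F' := by
  refine mul_nonneg (by positivity) (Finset.sum_nonneg fun _ _ => Finset.sum_nonneg fun _ _ =>
    Finset.sum_nonneg fun _ _ => mul_nonneg (pivotInd_nonneg ..) (by positivity))

/-- Some relabelled matrix contributes to a nonzero weight, and its relabelling carries the pivot
block onto the nodes of the two frames. -/
theorem submatrix_mul_eq_of_coupling_ne_zero {G : Matrix (Fin K') (Fin K) (ZMod 2)}
    {F : Frame r K} {F' : Frame r K'} (h : coupling ha hb hra hrb G F F' ≠ 0) :
    G.submatrix F'.1 F.1 * (F.2 : Matrix (Fin r) (Fin r) (ZMod 2)) = F'.2 := by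
  obtain ⟨G', -, h⟩ := Finset.exists_ne_zero_of_sum_ne_zero (right_ne_zero_of_mul h)
  obtain ⟨σ, -, h⟩ := Finset.exists_ne_zero_of_sum_ne_zero h
  obtain ⟨τ, -, h⟩ := Finset.exists_ne_zero_of_sum_ne_zero h
  simp only [pivotInd, ne_eq, mul_eq_zero, not_or, ite_eq_right_iff, one_ne_zero, imp_false,
    not_not] at h
  obtain ⟨⟨⟨-, h1⟩, h2, h3⟩, h4⟩ := h
  rw [← h1, ← h2, ← h3, ← h4]
  congr 1
  ext i j
  simp [pivotBlock, corner]

/-- The marginal weights of the pairs of frames are all equal. -/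
theorem sum_coupling_eq_sum_coupling (F₁ F₂ : Frame r K) (F₁' F₂' : Frame r K') :
    ∑ G, coupling ha hb hra hrb G F₁ F₁' = ∑ G, coupling ha hb hra hrb G F₂ F₂' := by
  classical
  have hsum : ∀ (F : Frame r K) (F' : Frame r K'), ∑ G, coupling ha hb hra hrb G F F' =
      ((2 : ℝ) ^ (K' * K) * (K.factorial * K'.factorial) *
        Fintype.card (Matrix (Fin r) (Fin r) (ZMod 2))ˣ)⁻¹ *
      ∑ G', ∑ σ : Equiv.Perm (Fin K), ∑ τ : Equiv.Perm (Fin K'),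
        pivotInd ha hb hra hrb F F' G' σ τ := by
    intro F F'
    simp only [coupling]
    rw [← Finset.mul_sum, Finset.sum_comm]
    congr 1
    refine Finset.sum_congr rfl fun G' _ => ?_
    rw [Finset.sum_comm]
    refine Finset.sum_congr rfl fun σ _ => ?_
    rw [Finset.sum_comm]
    refine Finset.sum_congr rfl fun τ _ => ?_
    rw [← Finset.mul_sum, Finset.sum_ite_eq, if_pos (Finset.mem_univ _), mul_one]
  set c : ℝ := ((Finset.univ.filter fun σ : Equiv.Perm (Fin K) =>
    F₁.1.trans σ.toEmbedding = F₁.1).card : ℝ) with hc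
  set c' : ℝ := ((Finset.univ.filter fun σ : Equiv.Perm (Fin K') =>
    F₁'.1.trans σ.toEmbedding = F₁'.1).card : ℝ) with hc'
  -- The bases prescribe the pivot block `F'.2 * F.2⁻¹`. The numbers of permutations reaching the
  -- prescribed nodes are the constants `c` and `c'`, whatever the matrix.
  have hred : ∀ (F : Frame r K) (F' : Frame r K'),
      ∑ G', ∑ σ : Equiv.Perm (Fin K), ∑ τ : Equiv.Perm (Fin K'),
        pivotInd ha hb hra hrb F F' G' σ τ =
      (∑ G' : Matrix (Fin K') (Fin K) (ZMod 2),
        if (corner ha hb G').rank = r ∧ pivotBlock hra hrb (corner ha hb G') =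
          ((F'.2 * F.2⁻¹ : (Matrix (Fin r) (Fin r) (ZMod 2))ˣ) : Matrix (Fin r) (Fin r) (ZMod 2))
        then 1 else 0) * (c * c') := by
    intro F F'
    rw [Finset.sum_mul]
    refine Finset.sum_congr rfl fun G' _ => ?_
    simp only [pivotInd]
    simp_rw [← Finset.mul_sum, ← Finset.sum_mul]
    rw [Finset.sum_boole, Finset.sum_boole, hc, hc',
      card_perm_comp_eq F₁.1 F₁.1 _ F.1, card_perm_comp_eq F₁'.1 F₁'.1 _ F'.1]
    congr 1
    refine if_congr (and_congr_right fun _ => ?_) rfl rfl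
    rw [Units.val_mul, Units.eq_mul_inv_iff_mul_eq]
  rw [hsum, hsum, hred, hred]
  congr 2
  have hcorner := fun A : (Matrix (Fin r) (Fin r) (ZMod 2))ˣ => sum_corner ha hb fun B =>
    if B.rank = r ∧ pivotBlock hra hrb B = A then (1 : ℝ) else 0
  have h2 : ((2 : ℝ) ^ (K' * K))⁻¹ ≠ 0 := by positivity
  refine mul_left_cancel₀ h2 ?_
  rw [hcorner, hcorner]
  congr 1
  rw [Finset.sum_boole, Finset.sum_boole]
  congr 1
  convert card_pivotBlock_eq hra hrb _ _

theorem sum_mul_mul_factor {α β γ δ : Type*} [Fintype α] [Fintype β] [Fintype γ] [Fintype δ]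
    (X : β → δ → ℝ) (Y : α → ℝ) (Z : γ → ℝ) :
    ∑ x, ∑ y, ∑ z, ∑ w, X y w * (Y x * Z z) = (∑ y, ∑ w, X y w) * ((∑ x, Y x) * ∑ z, Z z) := by
  simp_rw [← Finset.sum_mul, ← Finset.mul_sum, ← Finset.sum_mul]
  rw [← Finset.mul_sum, ← Finset.sum_mul]

/-- Summation over the frames. -/
theorem sum_pivotInd (G : Matrix (Fin K') (Fin K) (ZMod 2)) (σ : Equiv.Perm (Fin K))
    (τ : Equiv.Perm (Fin K')) :
    ∑ F, ∑ F', pivotInd ha hb hra hrb F F' G σ τ =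
      (if (corner ha hb G).rank = r then 1 else 0) *
        Fintype.card (Matrix (Fin r) (Fin r) (ZMod 2))ˣ := by
  classical
  simp only [Fintype.sum_prod_type]
  refine Eq.trans ?_ ((sum_mul_mul_factor
    (fun B B' : (Matrix (Fin r) (Fin r) (ZMod 2))ˣ => if (corner ha hb G).rank = r ∧
      pivotBlock hra hrb (corner ha hb G) * B = B' then 1 else 0)
    (fun e => if ((pivotCols hra (corner ha hb G)).trans (Fin.castLEEmb ha)).trans
      σ.toEmbedding = e then 1 else 0)
    (fun f => if ((pivotRows hrb (corner ha hb G)).trans (Fin.castLEEmb hb)).trans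
      τ.toEmbedding = f then 1 else 0)).trans ?_)
  · refine Finset.sum_congr rfl fun e _ => Finset.sum_congr rfl fun B _ =>
      Finset.sum_congr rfl fun f _ => Finset.sum_congr rfl fun B' _ => ?_
    simp only [pivotInd]
  rw [Finset.sum_ite_eq, Finset.sum_ite_eq, if_pos (Finset.mem_univ _), if_pos (Finset.mem_univ _),
    mul_one, mul_one]
  by_cases h : (corner ha hb G).rank = r
  · obtain ⟨A, hA⟩ := isUnit_pivotBlock hra hrb _ h
    simp only [h, ← hA, true_and, ← Units.val_mul, Units.val_inj]
    simp
  · simp [h]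

theorem sum_comm_three {α β γ δ : Type*} [Fintype α] [Fintype β] [Fintype γ] [Fintype δ]
    (f : α → β → γ → δ → ℝ) :
    ∑ x, ∑ y, ∑ z, ∑ w, f x y z w = ∑ y, ∑ z, ∑ w, ∑ x, f x y z w := by
  rw [Finset.sum_comm]
  refine Finset.sum_congr rfl fun y _ => ?_
  rw [Finset.sum_comm]
  exact Finset.sum_congr rfl fun z _ => Finset.sum_comm

-- For a relabelled matrix whose corner has rank `r`, the basis on the sending side is free and the
-- rest of both frames is forced. The resulting factor, the order of the group of invertible
-- matrices, cancels against the normalization.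
open Classical in
theorem sum_sum_coupling (G : Matrix (Fin K') (Fin K) (ZMod 2)) :
    ∑ F, ∑ F', coupling ha hb hra hrb G F F' =
      ((2 : ℝ) ^ (K' * K) * (K.factorial * K'.factorial))⁻¹ *
      ∑ G', ∑ σ : Equiv.Perm (Fin K), ∑ τ : Equiv.Perm (Fin K'),
        (if (corner ha hb G').rank = r then 1 else 0) *
          if G'.submatrix τ.symm σ.symm = G then 1 else 0 := by
  simp only [coupling]
  have hGL : (Fintype.card (Matrix (Fin r) (Fin r) (ZMod 2))ˣ : ℝ) ≠ 0 := by
    exact_mod_cast Fintype.card_ne_zero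
  simp_rw [← Finset.mul_sum]
  rw [mul_inv, mul_assoc]
  congr 1
  rw [inv_mul_eq_iff_eq_mul₀ hGL]
  refine (Finset.sum_congr rfl fun F _ => sum_comm_three _).trans ((sum_comm_three _).trans ?_)
  rw [Finset.mul_sum]
  simp_rw [Finset.mul_sum]
  refine Finset.sum_congr rfl fun G' _ => Finset.sum_congr rfl fun σ _ =>
    Finset.sum_congr rfl fun τ _ => ?_
  simp_rw [← Finset.sum_mul]
  rw [sum_pivotInd]
  ring

theorem sum_perm_const (x : ℝ) :
    ∑ _σ : Equiv.Perm (Fin K), ∑ _τ : Equiv.Perm (Fin K'), x = K.factorial * K'.factorial * x := by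
  simp [Fintype.card_perm, mul_assoc]

theorem sum_coupling_total :
    ∑ F, ∑ F', ∑ G, coupling ha hb hra hrb G F F' = rankProb b a r := by
  classical
  have h1 : ∑ F, ∑ F', ∑ G, coupling ha hb hra hrb G F F' =
      ∑ G, ∑ F, ∑ F', coupling ha hb hra hrb G F F' := by
    exact (Finset.sum_congr rfl fun F _ => Finset.sum_comm).trans Finset.sum_comm
  rw [h1]
  simp_rw [sum_sum_coupling]
  rw [← Finset.mul_sum, sum_comm_three, rankProb, ← sum_corner ha hb, mul_inv, mul_assoc]
  congr 1
  rw [inv_mul_eq_iff_eq_mul₀ (by positivity), Finset.mul_sum]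
  refine Finset.sum_congr rfl fun G' _ => ?_
  rw [← sum_perm_const]
  refine Finset.sum_congr rfl fun σ _ => Finset.sum_congr rfl fun τ _ => ?_
  rw [← Finset.mul_sum, Finset.sum_ite_eq, if_pos (Finset.mem_univ _), mul_one]

/-- All pairs of frames are connected with the same weight. -/
theorem sum_coupling (F : Frame r K) (F' : Frame r K') :
    ∑ G, coupling ha hb hra hrb G F F' =
      rankProb b a r / (Fintype.card (Frame r K) * Fintype.card (Frame r K')) := by
  have h1 : (Fintype.card (Frame r K) : ℝ) ≠ 0 := by
    exact_mod_cast (Fintype.card_pos_iff.2 ⟨F⟩).ne'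
  have h2 : (Fintype.card (Frame r K') : ℝ) ≠ 0 := by
    exact_mod_cast (Fintype.card_pos_iff.2 ⟨F'⟩).ne'
  rw [eq_div_iff (mul_ne_zero h1 h2), ← sum_coupling_total ha hb hra hrb]
  simp_rw [fun F₂ F₂' => sum_coupling_eq_sum_coupling ha hb hra hrb F₂ F F₂' F']
  rw [Finset.sum_const, Finset.sum_const, Finset.card_univ, Finset.card_univ]
  simp only [nsmul_eq_mul]
  ring

/-- A corner has a single rank, and each pair of permutations takes just one matrix to `G`. Thus the
weights of all ranks together never use more than the probability of `G`. -/
theorem sum_sum_sum_coupling_le {s : ℕ} (hsa : s ≤ a) (hsb : s ≤ b)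
    (G : Matrix (Fin K') (Fin K) (ZMod 2)) :
    ∑ r : Fin (s + 1), ∑ F, ∑ F', coupling ha hb (r.is_le.trans hsa) (r.is_le.trans hsb) G F F' ≤
      ((2 : ℝ) ^ (K' * K))⁻¹ := by
  classical
  simp_rw [sum_sum_coupling]
  rw [← Finset.mul_sum, mul_inv, mul_assoc]
  refine mul_le_of_le_one_right (by positivity) ?_
  rw [inv_mul_le_iff₀ (by positivity), mul_one, sum_comm_three]
  simp_rw [← Finset.sum_mul]
  have hle : ∀ G' : Matrix (Fin K') (Fin K) (ZMod 2),
      ∑ r : Fin (s + 1), (if (corner ha hb G').rank = (r : ℕ) then (1 : ℝ) else 0) ≤ 1 := by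
    intro G'
    rw [Finset.sum_boole]
    refine Nat.cast_le_one.2 (Finset.card_le_one.2 fun i hi j hj => Fin.ext ?_)
    exact (Finset.mem_filter.1 hi).2.symm.trans (Finset.mem_filter.1 hj).2
  calc _ ≤ ∑ G', ∑ σ : Equiv.Perm (Fin K), ∑ τ : Equiv.Perm (Fin K'),
        1 * (if G'.submatrix τ.symm σ.symm = G then (1 : ℝ) else 0) :=
        Finset.sum_le_sum fun G' _ => Finset.sum_le_sum fun σ _ => Finset.sum_le_sum fun τ _ =>
          mul_le_mul_of_nonneg_right (hle G') (by positivity)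
    _ ≤ ∑ _σ : Equiv.Perm (Fin K), ∑ _τ : Equiv.Perm (Fin K'), (1 : ℝ) := by
        rw [Finset.sum_comm]
        refine Finset.sum_le_sum fun σ _ => ?_
        rw [Finset.sum_comm]
        refine Finset.sum_le_sum fun τ _ => ?_
        simp_rw [one_mul]
        rw [Finset.sum_boole]
        refine Nat.cast_le_one.2 (Finset.card_le_one.2 fun X hX Y hY => ?_)
        have h := (Finset.mem_filter.1 hX).2.trans (Finset.mem_filter.1 hY).2.symm
        ext i j
        simpa using congrFun (congrFun h (τ i)) (σ j)
    _ = _ := by rw [sum_perm_const, mul_one]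

end

/-! ### Weights of chains of frames and their rounding -/

/-- Two distinct coordinates of a uniform tuple are independent and uniform. This averages out all
frames of a chain except the two at the ends of a hop. -/
theorem sum_pi_two {ι : Type*} [Fintype ι] [DecidableEq ι] {κ : ι → Type*}
    [∀ i, Fintype (κ i)] [∀ i, Nonempty (κ i)] {i j : ι} (hij : i ≠ j) (g : κ i → κ j → ℝ) :
    ∑ x : (l : ι) → κ l, g (x i) (x j) *
      (Fintype.card (κ i) * Fintype.card (κ j) / ∏ l, (Fintype.card (κ l) : ℝ))
      = ∑ y, ∑ z, g y z := by
  classical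
  have hcard : ∀ l, (Fintype.card (κ l) : ℝ) ≠ 0 := fun l => by
    exact_mod_cast Fintype.card_ne_zero
  have hprod : ∏ l, (Fintype.card (κ l) : ℝ) ≠ 0 := Finset.prod_ne_zero_iff.2 fun l _ => hcard l
  have hcount : ∀ y z, (∑ x : (l : ι) → κ l,
      (if x i = y then (1 : ℝ) else 0) * (if x j = z then 1 else 0)) *
      (Fintype.card (κ i) * Fintype.card (κ j)) = ∏ l, (Fintype.card (κ l) : ℝ) := by
    intro y z
    have h1 : ∀ x : (l : ι) → κ l,
        (if x i = y then (1 : ℝ) else 0) * (if x j = z then 1 else 0)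
        = ∏ l, ((if h : l = i then (if h ▸ x l = y then (1 : ℝ) else 0) else 1) *
          (if h : l = j then (if h ▸ x l = z then (1 : ℝ) else 0) else 1)) := by
      intro x
      rw [Finset.prod_mul_distrib]
      congr 1
      · rw [Finset.prod_eq_single i]
        · simp
        · intro b _ hb; simp [hb]
        · simp
      · rw [Finset.prod_eq_single j]
        · simp
        · intro b _ hb; simp [hb]
        · simp
    have hi : (Fintype.card (κ i) : ℝ) = ∏ l, if l = i then (Fintype.card (κ l) : ℝ) else 1 := by
      simp
    have hj : (Fintype.card (κ j) : ℝ) = ∏ l, if l = j then (Fintype.card (κ l) : ℝ) else 1 := by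
      simp
    rw [Finset.sum_congr rfl fun x _ => h1 x,
      sum_pi_prod (fun l v => (if h : l = i then (if h ▸ v = y then (1 : ℝ) else 0) else 1) *
          (if h : l = j then (if h ▸ v = z then (1 : ℝ) else 0) else 1)), hi, hj,
      ← Finset.prod_mul_distrib, ← Finset.prod_mul_distrib]
    refine Finset.prod_congr rfl fun l _ => ?_
    by_cases hli : l = i
    · subst hli
      simp [hij]
    · by_cases hlj : l = j
      · subst hlj
        simp [hli]
      · simp [hli, hlj]
  have hg : ∀ x : (l : ι) → κ l, g (x i) (x j) = ∑ y, ∑ z, g y z *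
      ((if x i = y then (1 : ℝ) else 0) * (if x j = z then 1 else 0)) := by
    intro x
    simp
  rw [← Finset.sum_mul, Finset.sum_congr rfl fun x _ => hg x, Finset.sum_comm]
  simp_rw [Finset.sum_comm (s := (Finset.univ : Finset ((l : ι) → κ l))), ← Finset.mul_sum]
  rw [Finset.sum_mul]
  refine Finset.sum_congr rfl fun y _ => ?_
  rw [Finset.sum_mul]
  refine Finset.sum_congr rfl fun z _ => ?_
  rw [mul_assoc, ← mul_div_assoc, hcount y z, div_self hprod, mul_one]

/-- Transport of frames along an equality of the numbers of nodes. -/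
def castFrame {r K K' : ℕ} (h : K = K') : Frame r K ≃ Frame r K' :=
  (Equiv.embeddingCongr (Equiv.refl _) (finCongr h)).prodCongr (Equiv.refl _)

/-- If only the second alternative of the dimension condition holds, the corner is `a × b` instead
of `b × a`. Transposition preserves the rank law, so the weight of a pair of frames has the same
form in both cases. -/
theorem exists_hop_weights {K K' a b s : ℕ} (hsa : s ≤ a) (hsb : s ≤ b)
    (h : (a ≤ K ∧ b ≤ K') ∨ (b ≤ K ∧ a ≤ K')) :
    ∃ u : (r : Fin (s + 1)) → Matrix (Fin K') (Fin K) (ZMod 2) → Frame r K → Frame r K' → ℝ,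
      (∀ r G F F', 0 ≤ u r G F F') ∧
      (∀ r G F F', u r G F F' ≠ 0 →
        G.submatrix F'.1 F.1 * (F.2 : Matrix (Fin r) (Fin r) (ZMod 2)) = F'.2) ∧
      (∀ r F F', ∑ G, u r G F F' =
        rankProb b a r / (Fintype.card (Frame r K) * Fintype.card (Frame r K'))) ∧
      ∀ G, ∑ r, ∑ F, ∑ F', u r G F F' ≤ ((2 : ℝ) ^ (K' * K))⁻¹ := by
  rcases h with ⟨ha, hb⟩ | ⟨hb, ha⟩
  · exact ⟨fun r => coupling ha hb (r.is_le.trans hsa) (r.is_le.trans hsb),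
      fun r G F F' => coupling_nonneg ..,
      fun r G F F' h => submatrix_mul_eq_of_coupling_ne_zero _ _ _ _ h,
      fun r F F' => sum_coupling .., sum_sum_sum_coupling_le ha hb hsa hsb⟩
  · exact ⟨fun r => coupling hb ha (r.is_le.trans hsb) (r.is_le.trans hsa),
      fun r G F F' => coupling_nonneg ..,
      fun r G F F' h => submatrix_mul_eq_of_coupling_ne_zero _ _ _ _ h,
      fun r F F' => by rw [rankProb_comm b a]; exact sum_coupling ..,
      sum_sum_sum_coupling_le hb ha hsb hsa⟩

theorem sum_rankProb_mul {a b s : ℕ} (hs : s = min a b) :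
    ∑ r : Fin (s + 1), rankProb b a r * (r : ℕ) =
      ((2 : ℝ) ^ (b * a))⁻¹ * ∑ B : Matrix (Fin b) (Fin a) (ZMod 2), (B.rank : ℝ) := by
  simp only [rankProb]
  simp_rw [mul_assoc, Finset.sum_mul]
  rw [← Finset.mul_sum, Finset.sum_comm]
  congr 1
  refine Finset.sum_congr rfl fun B _ => ?_
  have hB : B.rank < s + 1 := by
    have h1 := B.rank_le_width
    have h2 := B.rank_le_height
    omega
  rw [Finset.sum_eq_single ⟨B.rank, hB⟩]
  · simp
  · intro r _ hr
    rw [if_neg fun h => hr (Fin.ext h.symm), zero_mul]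
  · simp

/-- Rounding of fractional weights to slots: `c θ` slots of type `θ` are assigned to distinct
occurrences of elements `G` with `w G θ ≠ 0`. -/
theorem exists_pick {X Θ : Type*} [Fintype X] [Fintype Θ] {w : X → Θ → ℝ} {p x : ℝ} {q : Θ → ℝ}
    (hx : 0 ≤ x) (hw0 : ∀ G θ, 0 ≤ w G θ) (hq : ∀ θ, ∑ G, w G θ = q θ) (hp : ∀ G, ∑ θ, w G θ ≤ p)
    {Γ : ℝ} (hΓ : Fintype.card X ≤ Γ) :
    ∃ pick : (Σ θ, Fin ⌊x * q θ - Γ⌋₊) → X × ℕ, Function.Injective pick ∧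
      ∀ s, w (pick s).1 s.1 ≠ 0 ∧ ((pick s).2 : ℝ) < x * p := by
  classical
  set d : X → Θ → ℕ := fun G θ => ⌊x * w G θ⌋₊ with hd
  have h1 : ∀ θ, Nonempty (Fin ⌊x * q θ - Γ⌋₊ ↪ Σ G, Fin (d G θ)) := by
    intro θ
    refine Function.Embedding.nonempty_of_card_le ?_
    rw [Fintype.card_fin, Fintype.card_sigma]
    simp only [Fintype.card_fin]
    refine Nat.floor_le_of_le ?_
    rw [Nat.cast_sum]
    -- Each floor loses less than one, and there are at most `Γ` matrices.
    calc x * q θ - Γ ≤ ∑ G, (x * w G θ - 1) := by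
          rw [Finset.sum_sub_distrib, ← Finset.mul_sum, hq]
          simp only [Finset.sum_const, Finset.card_univ, nsmul_eq_mul, mul_one]
          linarith
      _ ≤ _ := Finset.sum_le_sum fun G _ => (Nat.sub_one_lt_floor _).le
  -- The slots of different types using the same `G` are numbered jointly, so they receive distinct
  -- occurrences.
  have h2 : ∀ G, Nonempty ((Σ θ, Fin (d G θ)) ↪ Fin (∑ θ, d G θ)) := by
    intro G
    refine Function.Embedding.nonempty_of_card_le ?_
    simp [Fintype.card_sigma]
  have f := fun θ => (h1 θ).some
  have e := fun G => (h2 G).some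
  refine ⟨fun s => ((f s.1 s.2).1, (e (f s.1 s.2).1 ⟨s.1, (f s.1 s.2).2⟩ : Fin _)), ?_, ?_⟩
  · rintro ⟨θ, i⟩ ⟨θ', i'⟩ h
    have key : ∀ (y : Σ G, Fin (d G θ)) (y' : Σ G, Fin (d G θ')),
        y.1 = y'.1 → (e y.1 ⟨θ, y.2⟩ : ℕ) = (e y'.1 ⟨θ', y'.2⟩ : ℕ) →
        (⟨θ, y⟩ : Σ θ, Σ G, Fin (d G θ)) = ⟨θ', y'⟩ := by
      rintro ⟨G, j⟩ ⟨G', j'⟩ hG hj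
      dsimp only at hG hj
      subst hG
      have := (e G).injective (Fin.ext hj)
      cases this
      rfl
    have h3 := key _ _ (congrArg Prod.fst h) (congrArg Prod.snd h)
    have h4 : θ = θ' := congrArg Sigma.fst h3
    subst h4
    have h5 : i = i' := (f θ).injective (eq_of_heq (Sigma.mk.inj h3).2)
    rw [h5]
  · rintro ⟨θ, i⟩
    dsimp only
    generalize f θ i = y
    obtain ⟨G, j⟩ := y
    constructor
    · intro h0
      have : d G θ = 0 := by simp only [hd]; rw [h0]; simp
      exact absurd j.isLt (by omega)
    · calc ((e G ⟨θ, j⟩ : ℕ) : ℝ) < ((∑ θ, d G θ : ℕ) : ℝ) := by exact_mod_cast (e G ⟨θ, j⟩).isLt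
        _ ≤ ∑ θ, x * w G θ := by
            rw [Nat.cast_sum]
            exact Finset.sum_le_sum fun θ _ => Nat.floor_le (mul_nonneg hx (hw0 G θ))
        _ ≤ x * p := by
            rw [← Finset.mul_sum]
            exact mul_le_mul_of_nonneg_left (hp G) hx

namespace RelayNetwork

variable (N : RelayNetwork)

/-- The layer of the senders of the hop after `m`, with the last layer identified with the
first one. -/
def nextLayer (m : Fin N.M) : Fin N.M :=
  if h : (m : ℕ) + 1 < N.M then ⟨m + 1, h⟩ else N.firstHop

theorem K_nextLayer (m : Fin N.M) : N.K (N.nextLayer m) = N.K (m + 1) := by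
  unfold nextLayer
  split_ifs with h
  · rfl
  · have : (m : ℕ) + 1 = N.M := by omega
    rw [this, N.K_last]
    rfl

/-- Here `M ≥ 2` matters: with a single hop the sending and receiving frames would be the same
coordinate of the chain and could not be a uniform pair. -/
theorem nextLayer_ne (hM : 2 ≤ N.M) (m : Fin N.M) : m ≠ N.nextLayer m := by
  unfold nextLayer
  intro h
  have := congrArg Fin.val h
  split_ifs at this with h1
  · simp at this
  · simp only [firstHop] at this
    omega

/-- Types of slots: a frame of the same size in every layer. -/
abbrev Chain (s : ℕ) : Type := Σ r : Fin (s + 1), (m : Fin N.M) → Frame r (N.K m)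

variable {N}

/-- The frame of a chain in a layer; in the last layer it is that of the first layer. -/
def Chain.frame {s : ℕ} (θ : N.Chain s) (m : ℕ) (hm : m ≤ N.M) : Frame θ.1 (N.K m) :=
  if h : m < N.M then θ.2 ⟨m, h⟩
  else castFrame (by rw [show m = N.M by omega, N.K_last]; rfl) (θ.2 N.firstHop)

theorem Chain.frame_of_lt {s : ℕ} (θ : N.Chain s) (m : Fin N.M) :
    θ.frame m m.isLt.le = θ.2 m := dif_pos m.isLt

theorem Chain.frame_succ {s : ℕ} (θ : N.Chain s) (m : Fin N.M) :
    θ.frame (m + 1) m.isLt = castFrame (N.K_nextLayer m) (θ.2 (N.nextLayer m)) := by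
  have key : ∀ (j : Fin N.M) (_ : N.nextLayer m = j) (hK : N.K j = N.K (m + 1)),
      castFrame hK (θ.2 j) = castFrame (N.K_nextLayer m) (θ.2 (N.nextLayer m)) := by
    rintro _ rfl _
    rfl
  unfold Chain.frame
  by_cases h : (m : ℕ) + 1 < N.M
  · rw [dif_pos h]
    exact key ⟨m + 1, h⟩ (dif_pos h) rfl
  · rw [dif_neg h]
    exact key N.firstHop (dif_neg h) _

/-- The weight of a chain. -/
noncomputable def chainWeight (b a : ℕ) {s : ℕ} (θ : N.Chain s) : ℝ :=
  rankProb b a θ.1 / ∏ m : Fin N.M, (Fintype.card (Frame θ.1 (N.K m)) : ℝ)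

theorem chainWeight_nonneg (b a : ℕ) {s : ℕ} (θ : N.Chain s) : 0 ≤ chainWeight b a θ :=
  div_nonneg (rankProb_nonneg ..) (Finset.prod_nonneg fun _ _ => by positivity)

theorem sum_chainWeight_mul {b a s : ℕ} (hs : s = min a b) (hK : ∀ m : Fin N.M, s ≤ N.K m) :
    ∑ θ : N.Chain s, chainWeight b a θ * (θ.1 : ℕ) =
      ((2 : ℝ) ^ (b * a))⁻¹ * ∑ B : Matrix (Fin b) (Fin a) (ZMod 2), (B.rank : ℝ) := by
  rw [← sum_rankProb_mul hs, Fintype.sum_sigma]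
  refine Finset.sum_congr rfl fun r _ => ?_
  change ∑ _x : ((m : Fin N.M) → Frame r (N.K m)), rankProb b a r /
    (∏ m : Fin N.M, (Fintype.card (Frame r (N.K m)) : ℝ)) * (r : ℕ) = _
  rw [Finset.sum_const, Finset.card_univ, Fintype.card_pi, nsmul_eq_mul, Nat.cast_prod,
    ← mul_assoc, mul_div_cancel₀]
  refine Finset.prod_ne_zero_iff.2 fun m _ => ?_
  have : Nonempty (Frame r (N.K m)) := ⟨(Fin.castLEEmb (r.is_le.trans (hK m)), 1)⟩
  exact_mod_cast Fintype.card_ne_zero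

/-- Given the two frames at hop `m`, the others are taken uniform and independent. Because all pairs
have equal weight, the total weight of a chain does not depend on `m`, so the same slots can be
planned at every hop. -/
theorem exists_chain_weights (hM : 2 ≤ N.M) {a b s : ℕ} (hsa : s ≤ a) (hsb : s ≤ b)
    (h : ∀ m : Fin N.M, (a ≤ N.K m ∧ b ≤ N.K (m + 1)) ∨ (b ≤ N.K m ∧ a ≤ N.K (m + 1)))
    (m : Fin N.M) :
    ∃ w : N.ChannelMatrix m → N.Chain s → ℝ,
      (∀ G θ, 0 ≤ w G θ) ∧
      (∀ G θ, w G θ ≠ 0 → G.submatrix (θ.frame (m + 1) m.isLt).1 (θ.frame m m.isLt.le).1 *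
        ((θ.frame m m.isLt.le).2 : Matrix (Fin θ.1) (Fin θ.1) (ZMod 2)) =
          (θ.frame (m + 1) m.isLt).2) ∧
      (∀ θ, ∑ G, w G θ = chainWeight b a θ) ∧
      ∀ G, ∑ θ, w G θ ≤ ((2 : ℝ) ^ (N.K (m + 1) * N.K m))⁻¹ := by
  obtain ⟨u, hu0, hu1, hu2, hu3⟩ := exists_hop_weights hsa hsb (h m)
  have hcast : ∀ r : ℕ, Fintype.card (Frame r (N.K (N.nextLayer m)))
      = Fintype.card (Frame r (N.K (m + 1))) := fun r => by rw [N.K_nextLayer m]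
  refine ⟨fun G θ => u θ.1 G (θ.2 m) (castFrame (N.K_nextLayer m) (θ.2 (N.nextLayer m))) *
    (Fintype.card (Frame θ.1 (N.K m)) * Fintype.card (Frame θ.1 (N.K (N.nextLayer m))) /
      ∏ l : Fin N.M, (Fintype.card (Frame θ.1 (N.K l)) : ℝ)), ?_, ?_, ?_, ?_⟩
  · intro G θ
    exact mul_nonneg (hu0 ..) (div_nonneg (by positivity)
      (Finset.prod_nonneg fun _ _ => by positivity))
  · intro G θ hne
    rw [θ.frame_succ, θ.frame_of_lt]
    exact hu1 _ _ _ _ (left_ne_zero_of_mul hne)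
  · intro θ
    rw [← Finset.sum_mul, hu2, chainWeight, hcast]
    have h1 : (Fintype.card (Frame θ.1 (N.K m)) : ℝ) ≠ 0 := by
      exact_mod_cast (Fintype.card_pos_iff.2 ⟨θ.2 m⟩).ne'
    have h2 : (Fintype.card (Frame θ.1 (N.K (m + 1))) : ℝ) ≠ 0 := by
      rw [← hcast]
      exact_mod_cast (Fintype.card_pos_iff.2 ⟨θ.2 (N.nextLayer m)⟩).ne'
    rw [div_mul_div_cancel₀ (mul_ne_zero h1 h2)]
  · intro G
    refine le_trans (le_of_eq ?_) (hu3 G)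
    rw [Fintype.sum_sigma]
    refine Finset.sum_congr rfl fun r _ => ?_
    have hs : ∀ l : Fin N.M, s ≤ N.K l := fun l => by
      rcases h l with h | h <;> omega
    have : ∀ l : Fin N.M, Nonempty (Frame r (N.K l)) := fun l =>
      ⟨(Fin.castLEEmb (r.is_le.trans (hs l)), 1)⟩
    rw [sum_pi_two (κ := fun l : Fin N.M => Frame r (N.K l)) (N.nextLayer_ne hM m)
      (fun F F' => u r G F (castFrame (N.K_nextLayer m) F'))]
    exact Finset.sum_congr rfl fun F _ => Equiv.sum_comp (castFrame (N.K_nextLayer m)) _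

end RelayNetwork

/-! ### Schedules and the pipelined block code -/

namespace RelayNetwork

/-- A schedule of slots in the blocks of time.  In its block of hop `m`, the slot `s` is served by
the occurrence number `(pick m s).2` of the channel matrix `(pick m s).1`; the nodes of its frames
are then active. -/
structure Schedule (N : RelayNetwork) (S : Type) where
  size : S → ℕ
  frame : (m : ℕ) → m ≤ N.M → (s : S) → Frame (size s) (N.K m)
  pick : (m : Fin N.M) → S → N.ChannelMatrix m × ℕ
  pick_injective : ∀ m, Function.Injective (pick m)
  submatrix_mul : ∀ (m : Fin N.M) (s : S),
    (pick m s).1.submatrix (frame (m + 1) m.isLt s).1 (frame m m.isLt.le s).1 *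
      ((frame m m.isLt.le s).2 : Matrix (Fin (size s)) (Fin (size s)) (ZMod 2)) =
        (frame (m + 1) m.isLt s).2
  frame_dest : ∀ s i, (frame (N.lastHop + 1) N.lastHop.isLt s).1 i =
    N.dest ((frame 0 (Nat.zero_le _) s).1 i)
  basis_dest : ∀ s, (frame (N.lastHop + 1) N.lastHop.isLt s).2 = (frame 0 (Nat.zero_le _) s).2

variable {N : RelayNetwork} {n : ℕ}

/-- The number of earlier occurrences, in the same block of length `B`, of the channel matrix of
hop `m` at time `t`. -/
def occurrence (B : ℕ) (H : N.ChannelSeq n) (m : Fin N.M) (t : Fin n) : ℕ :=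
  (Finset.univ.filter fun τ : Fin n => τ < t ∧ (τ : ℕ) / B = t / B ∧ H τ m = H t m).card

/-- Causality: occurrence numbers can be computed from the matrices up to the present time. -/
theorem occurrence_congr {B : ℕ} {H H' : N.ChannelSeq n} {m : Fin N.M} {t : Fin n}
    (h : ∀ τ ≤ t, H τ m = H' τ m) : occurrence B H m t = occurrence B H' m t := by
  unfold occurrence
  congr 1
  refine Finset.filter_congr fun τ _ => and_congr_right fun hτ => ?_
  rw [h τ hτ.le, h t le_rfl]

theorem eq_of_occurrence_eq {B : ℕ} {H : N.ChannelSeq n} {m : Fin N.M} {t t' : Fin n}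
    (hB : (t : ℕ) / B = t' / B) (hH : H t m = H t' m)
    (h : occurrence B H m t = occurrence B H m t') : t = t' := by
  have key : ∀ t t' : Fin n, (t : ℕ) / B = t' / B → H t m = H t' m → t < t' →
      occurrence B H m t < occurrence B H m t' := by
    intro t t' hB hH hlt
    refine Finset.card_lt_card ⟨?_, ?_⟩
    · intro τ hτ
      simp only [Finset.mem_filter, Finset.mem_univ, true_and] at hτ ⊢
      exact ⟨hτ.1.trans hlt, hτ.2.1.trans hB, hτ.2.2.trans hH⟩
    · intro hsub
      have := hsub (Finset.mem_filter.2 ⟨Finset.mem_univ t, hlt, hB, hH⟩)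
      exact lt_irrefl _ (Finset.mem_filter.1 this).2.1
  rcases lt_trichotomy t t' with hlt | heq | hlt
  · exact absurd h (key t t' hB hH hlt).ne
  · exact heq
  · exact absurd h (key t' t hB.symm hH.symm hlt).ne'

/-- The times in block `β` at which hop `m` has the channel matrix `G`. -/
def timesOf (B : ℕ) (H : N.ChannelSeq n) (m : Fin N.M) (β : ℕ) (G : N.ChannelMatrix m) :
    Finset (Fin n) :=
  Finset.univ.filter fun t : Fin n => (t : ℕ) / B = β ∧ H t m = G

/-- Occurrence numbers inject the times of `G` in the block into an initial segment of the same
size, so every number is attained. -/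
theorem exists_occurrence_eq {B : ℕ} {H : N.ChannelSeq n} {m : Fin N.M} {β : ℕ}
    {G : N.ChannelMatrix m} {j : ℕ} (hj : j < (timesOf B H m β G).card) :
    ∃ t : Fin n, (t : ℕ) / B = β ∧ H t m = G ∧ occurrence B H m t = j := by
  have hmaps : ∀ t ∈ timesOf B H m β G,
      occurrence B H m t ∈ Finset.range (timesOf B H m β G).card := by
    intro t ht
    obtain ⟨h1, h2⟩ := (Finset.mem_filter.1 ht).2
    refine Finset.mem_range.2 (Finset.card_lt_card ⟨?_, ?_⟩)
    · intro τ hτ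
      obtain ⟨-, h3, h4⟩ := (Finset.mem_filter.1 hτ).2
      exact Finset.mem_filter.2 ⟨Finset.mem_univ _, h3.trans h1, h4.trans h2⟩
    · intro hsub
      exact lt_irrefl _ (Finset.mem_filter.1 (hsub ht)).2.1
  have hinj : Set.InjOn (occurrence B H m) (timesOf B H m β G) := by
    intro t ht t' ht' h
    obtain ⟨h1, h2⟩ := (Finset.mem_filter.1 (Finset.mem_coe.1 ht)).2
    obtain ⟨h3, h4⟩ := (Finset.mem_filter.1 (Finset.mem_coe.1 ht')).2
    exact eq_of_occurrence_eq (h1.trans h3.symm) (h2.trans h4.symm) h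
  have := Finset.surj_on_of_inj_on_of_card_le (s := timesOf B H m β G)
    (t := Finset.range (timesOf B H m β G).card) (fun t _ => occurrence B H m t) hmaps
    (fun t t' ht ht' h => hinj ht ht' h) (by simp) j (Finset.mem_range.2 hj)
  obtain ⟨t, ht, h⟩ := this
  obtain ⟨h1, h2⟩ := (Finset.mem_filter.1 ht).2
  exact ⟨t, h1, h2, h.symm⟩

/-- The realization of the channels that is known to the transmitters of hop `m` at time `t`,
completed by zeros. -/
def extendCSI {m : Fin N.M} {t : Fin n} (c : N.CSI m t) : N.ChannelSeq n := fun τ l =>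
  if h : τ ≤ t ∧ l ≤ m then c ⟨τ, h.1⟩ ⟨l, h.2⟩ else 0

theorem extendCSI_csi (H : N.ChannelSeq n) {m l : Fin N.M} {t τ : Fin n} (hτ : τ ≤ t)
    (hl : l ≤ m) : extendCSI (N.csi H m t) τ l = H τ l := dif_pos ⟨hτ, hl⟩

namespace Schedule

variable {S : Type} (σ : N.Schedule S) (B : ℕ)

/-- Hop `m` serves the slot `s` at time `t`. -/
def Serves (H : N.ChannelSeq n) (m : Fin N.M) (t : Fin n) (s : S) : Prop :=
  σ.pick m s = (H t m, occurrence B H m t)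

variable {σ B}

theorem serves_congr {H H' : N.ChannelSeq n} {m : Fin N.M} {t : Fin n}
    (h : ∀ τ ≤ t, H τ m = H' τ m) (s : S) : σ.Serves B H m t s ↔ σ.Serves B H' m t s := by
  unfold Serves
  rw [occurrence_congr h, h t le_rfl]

/-- Transmitters can follow the schedule: only known matrices are consulted, and the zero completion
plays no role. -/
theorem serves_extendCSI {H : N.ChannelSeq n} {m l : Fin N.M} {t τ : Fin n} (hτ : τ ≤ t)
    (hl : l ≤ m) (s : S) :
    σ.Serves B (extendCSI (N.csi H m t)) l τ s ↔ σ.Serves B H l τ s :=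
  serves_congr (fun _ hτ' => extendCSI_csi H (hτ'.trans hτ) hl) s

theorem Serves.slot_eq {H : N.ChannelSeq n} {m : Fin N.M} {t : Fin n} {s s' : S}
    (h : σ.Serves B H m t s) (h' : σ.Serves B H m t s') : s = s' :=
  σ.pick_injective m (h.trans h'.symm)

theorem Serves.time_eq {H : N.ChannelSeq n} {m : Fin N.M} {t t' : Fin n} {s : S}
    (h : σ.Serves B H m t s) (h' : σ.Serves B H m t' s) (hB : (t : ℕ) / B = t' / B) : t = t' := by
  have := Prod.mk.inj (h.symm.trans h')
  exact eq_of_occurrence_eq hB this.1 this.2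

variable (σ B) {L : Fin (N.K 0) → ℕ} (hL : ∀ k, 0 < L k)
  (bit : (k : Fin (N.K 0)) → Fin (L k) → ℕ → S → ZMod 2) (Q : ℕ)

open Classical in
/-- The relaying code of a schedule.  Source `k` sends the bit `bit k w β s` of its message `w`
when slot `s` is served in block `β`; a relay forwards what it received in the same slot during the
previous block; the destination reads the first `Q` blocks off the symbols that it received
`M - 1` blocks later. -/
noncomputable def code [Fintype S] : N.Code n L where
  enc k t w c := ∑ s, if σ.Serves B (extendCSI c) N.firstHop t s ∧
    k ∈ Set.range (σ.frame 0 (Nat.zero_le _) s).1 then bit k w (t / B) s else 0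
  relay m hm k t y c := ∑ s, if σ.Serves B (extendCSI c) ⟨m + 1, hm⟩ t s ∧
    k ∈ Set.range (σ.frame (m + 1) hm.le s).1 then
      ∑ τ : {τ : Fin n // τ < t}, if (τ.1 : ℕ) / B + 1 = t / B ∧
        σ.Serves B (extendCSI c) ⟨m, Nat.lt_of_succ_lt hm⟩ τ.1 s then y τ else 0
    else 0
  dec k y H :=
    if h : ∃ w : Fin (L k), ∀ β < Q, ∀ s, k ∈ Set.range (σ.frame 0 (Nat.zero_le _) s).1 →
      bit k w β s = ∑ τ : Fin n, if (τ : ℕ) / B = β + (N.M - 1) ∧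
        σ.Serves B H N.lastHop τ s then y τ else 0
    then h.choose else ⟨0, hL k⟩

/-- Every slot is served by every hop in each of the first `Q` blocks. -/
def AllServed (H : N.ChannelSeq n) : Prop :=
  ∀ m : Fin N.M, ∀ β < Q, ∀ s, ∃ t : Fin n, (t : ℕ) / B = β ∧ σ.Serves B H m t s

variable {σ B hL bit Q} {H : N.ChannelSeq n} (W : (k : Fin (N.K 0)) → Fin (L k))

/-- The vector carried by slot `s` in block `β`, in the basis of the first layer. -/
noncomputable def latent (σ : N.Schedule S)
    (bit : (k : Fin (N.K 0)) → Fin (L k) → ℕ → S → ZMod 2) (W : (k : Fin (N.K 0)) → Fin (L k))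
    (β : ℕ) (s : S) : Fin (σ.size s) → ZMod 2 :=
  (((σ.frame 0 (Nat.zero_le _) s).2⁻¹ : (Matrix (Fin (σ.size s)) (Fin (σ.size s)) (ZMod 2))ˣ) :
    Matrix (Fin (σ.size s)) (Fin (σ.size s)) (ZMod 2)) *ᵥ
    fun i => bit ((σ.frame 0 (Nat.zero_le _) s).1 i) (W ((σ.frame 0 (Nat.zero_le _) s).1 i)) β s

/-- Nodes outside the frame are silent, so only the submatrix between the two frames acts, and it
carries one basis to the other. -/
theorem rx_of_tx {c : N.Code n L} {m : Fin N.M} {t : Fin n} {s : S} {z : Fin (σ.size s) → ZMod 2}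
    (hs : σ.Serves B H m t s)
    (h1 : ∀ i, c.tx W H m m.isLt t ((σ.frame m m.isLt.le s).1 i) =
      (((σ.frame m m.isLt.le s).2 : Matrix (Fin (σ.size s)) (Fin (σ.size s)) (ZMod 2)) *ᵥ z) i)
    (h2 : ∀ k ∉ Set.range (σ.frame m m.isLt.le s).1, c.tx W H m m.isLt t k = 0)
    (i : Fin (σ.size s)) :
    c.rx W H m t ((σ.frame (m + 1) m.isLt s).1 i) =
      (((σ.frame (m + 1) m.isLt s).2 : Matrix (Fin (σ.size s)) (Fin (σ.size s)) (ZMod 2)) *ᵥ z)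
        i := by
  rw [← σ.submatrix_mul m s, ← mulVec_mulVec, hs]
  simp only [Code.rx, mulVec, dotProduct, submatrix_apply]
  have hinj := (σ.frame m m.isLt.le s).1.injective
  rw [← Finset.sum_subset (Finset.subset_univ (Finset.univ.map (σ.frame m m.isLt.le s).1)),
    Finset.sum_map]
  · exact Finset.sum_congr rfl fun j _ => by rw [h1 j]; rfl
  · intro k _ hk
    rw [h2 k (by simpa using hk), mul_zero]

/-- Pipelining: the vector of slot `s` that enters in block `β` crosses hop `m` in block `β + m`,
expressed in the basis of layer `m`. The decoding depth `Q'` is free because it affects only the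
decoder. -/
theorem tx_code [Fintype S] (hH : σ.AllServed B Q H) (m : ℕ) (hm : m < N.M) {β : ℕ} (hβ : β + m < Q)
    {t : Fin n} {s : S} (ht : (t : ℕ) / B = β + m) (hs : σ.Serves B H ⟨m, hm⟩ t s) {Q' : ℕ} :
    (∀ i, (σ.code B hL bit Q').tx W H m hm t ((σ.frame m hm.le s).1 i) =
      (((σ.frame m hm.le s).2 : Matrix (Fin (σ.size s)) (Fin (σ.size s)) (ZMod 2)) *ᵥ
        latent σ bit W β s) i) ∧
    ∀ k ∉ Set.range (σ.frame m hm.le s).1, (σ.code B hL bit Q').tx W H m hm t k = 0 := by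
  classical
  induction m generalizing t with
  | zero =>
    have htx : ∀ k, (σ.code B hL bit Q').tx W H 0 hm t k =
        if k ∈ Set.range (σ.frame 0 (Nat.zero_le _) s).1 then bit k (W k) β s else 0 := by
      intro k
      change (∑ s', if σ.Serves B (extendCSI (N.csi H N.firstHop t)) N.firstHop t s' ∧
        k ∈ Set.range (σ.frame 0 (Nat.zero_le _) s').1 then bit k (W k) (t / B) s' else 0) = _
      simp_rw [serves_extendCSI (σ := σ) (B := B) (H := H) (le_refl t) (le_refl N.firstHop)]
      rw [Finset.sum_eq_single s]
      · rw [ht]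
        simp only [show σ.Serves B H N.firstHop t s from hs, true_and, add_zero]
      · intro s' _ hne
        exact if_neg fun h => hne (h.1.slot_eq hs)
      · simp
    refine ⟨fun i => ?_, fun k hk => by rw [htx, if_neg hk]⟩
    rw [htx, if_pos ⟨i, rfl⟩, latent, mulVec_mulVec, Units.mul_inv, one_mulVec]
  | succ m ih =>
    have hm' : m < N.M := Nat.lt_of_succ_lt hm
    obtain ⟨t₀, ht₀, hs₀⟩ := hH ⟨m, hm'⟩ (β + m) (by omega) s
    obtain ⟨h1, h2⟩ := ih hm' (by omega) ht₀ hs₀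
    have hlt : t₀ < t := by
      by_contra hge
      have : (t : ℕ) / B ≤ t₀ / B := Nat.div_le_div_right (by simpa using hge)
      omega
    have htx : ∀ k, (σ.code B hL bit Q').tx W H (m + 1) hm t k =
        if k ∈ Set.range (σ.frame (m + 1) hm.le s).1 then
          (σ.code B hL bit Q').rx W H ⟨m, hm'⟩ t₀ k else 0 := by
      intro k
      rw [Code.tx_succ]
      change (∑ s', if σ.Serves B (extendCSI (N.csi H ⟨m + 1, hm⟩ t)) ⟨m + 1, hm⟩ t s' ∧
        k ∈ Set.range (σ.frame (m + 1) hm.le s').1 then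
        ∑ τ : {τ : Fin n // τ < t}, if (τ.1 : ℕ) / B + 1 = t / B ∧
          σ.Serves B (extendCSI (N.csi H ⟨m + 1, hm⟩ t)) ⟨m, hm'⟩ τ.1 s' then
          (σ.code B hL bit Q').rx W H ⟨m, hm'⟩ τ.1 k else 0 else 0) = _
      rw [Finset.sum_eq_single s]
      · refine if_congr ?_ ?_ rfl
        · rw [serves_extendCSI (σ := σ) (B := B) (H := H) (le_refl t) (le_refl _)]
          exact and_iff_right hs
        -- In the preceding block `t₀` is the only time at which the previous hop serves `s`, so the
        -- relay's sum returns the symbol received then.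
        · rw [Finset.sum_eq_single (⟨t₀, hlt⟩ : {τ : Fin n // τ < t})]
          · rw [if_pos]
            refine ⟨by simp only; omega, ?_⟩
            rw [serves_extendCSI (σ := σ) (B := B) (H := H) hlt.le (Nat.le_succ m)]
            exact hs₀
          · intro τ _ hne
            refine if_neg fun h => hne (Subtype.ext ?_)
            rw [serves_extendCSI (σ := σ) (B := B) (H := H) τ.2.le (Nat.le_succ m)] at h
            obtain ⟨h3, h4⟩ := h
            change τ.1 = t₀
            exact h4.time_eq hs₀ (by omega)
          · simp
      · intro s' _ hne
        refine if_neg fun h => hne ?_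
        rw [serves_extendCSI (σ := σ) (B := B) (H := H) (le_refl t) (le_refl _)] at h
        exact h.1.slot_eq hs
      · simp
    refine ⟨fun i => ?_, fun k hk => by rw [htx, if_neg hk]⟩
    rw [htx, if_pos ⟨i, rfl⟩]
    exact rx_of_tx W hs₀ h1 h2 i

/-- The first and last bases coincide, so the `F⁻¹` in `latent` cancels and the destination receives
the source bit itself. The true message passes the decoder's test, and `hbit` makes it the only one.
-/
theorem decoded_code [Fintype S] (hH : σ.AllServed B Q H) {Q' : ℕ} (hQ : Q' + (N.M - 1) ≤ Q)
    (hbit : ∀ k w w', (∀ β < Q', ∀ s, k ∈ Set.range (σ.frame 0 (Nat.zero_le _) s).1 →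
      bit k w β s = bit k w' β s) → w = w') (k : Fin (N.K 0)) :
    (σ.code B hL bit Q').decoded W H k = W k := by
  classical
  have key : ∀ β < Q', ∀ s, k ∈ Set.range (σ.frame 0 (Nat.zero_le _) s).1 →
      bit k (W k) β s = ∑ τ : Fin n, if (τ : ℕ) / B = β + (N.M - 1) ∧
        σ.Serves B H N.lastHop τ s then
          (σ.code B hL bit Q').rx W H N.lastHop τ (N.dest k) else 0 := by
    rintro β hβ s ⟨i, rfl⟩
    obtain ⟨t₀, ht₀, hs₀⟩ := hH N.lastHop (β + (N.M - 1)) (by omega) s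
    rw [Finset.sum_eq_single t₀]
    · rw [if_pos ⟨ht₀, hs₀⟩, ← σ.frame_dest]
      obtain ⟨h1, h2⟩ := tx_code (hL := hL) (bit := bit) W hH N.lastHop N.lastHop.isLt
        (β := β) (show β + (N.M - 1) < Q by omega) ht₀ hs₀ (Q' := Q')
      rw [rx_of_tx W hs₀ h1 h2 i, σ.basis_dest, latent, mulVec_mulVec, Units.mul_inv, one_mulVec]
    · intro τ _ hne
      exact if_neg fun h => hne (h.2.time_eq hs₀ (h.1.trans ht₀.symm))
    · simp
  have hex : ∃ w : Fin (L k), ∀ β < Q', ∀ s, k ∈ Set.range (σ.frame 0 (Nat.zero_le _) s).1 →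
      bit k w β s = ∑ τ : Fin n, if (τ : ℕ) / B = β + (N.M - 1) ∧
        σ.Serves B H N.lastHop τ s then
          (σ.code B hL bit Q').rx W H N.lastHop τ (N.dest k) else 0 := ⟨W k, key⟩
  have hdec : (σ.code B hL bit Q').decoded W H k = hex.choose := dif_pos hex
  rw [hdec]
  exact hbit k _ _ fun β hβ s hs => (hex.choose_spec β hβ s hs).trans (key β hβ s hs).symm

open Classical in
theorem errorProb_code_le [Fintype S] {Q' : ℕ} (hQ : Q' + (N.M - 1) ≤ Q)
    (hbit : ∀ k w w', (∀ β < Q', ∀ s, k ∈ Set.range (σ.frame 0 (Nat.zero_le _) s).1 →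
      bit k w β s = bit k w' β s) → w = w') (k : Fin (N.K 0)) :
    (σ.code (n := n) B hL bit Q').errorProb k ≤
      ∑ H : N.ChannelSeq n, N.channelProb H * (if ¬ σ.AllServed B Q H then 1 else 0) := by
  calc _ ≤ ∑ _W : (k : Fin (N.K 0)) → Fin (L k), (∏ i, (L i : ℝ)⁻¹) *
        ∑ H : N.ChannelSeq n, N.channelProb H * (if ¬ σ.AllServed B Q H then 1 else 0) := by
        simp only [Code.errorProb]
        refine Finset.sum_le_sum fun W _ => ?_
        rw [Finset.mul_sum]
        refine Finset.sum_le_sum fun H _ => ?_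
        rw [mul_assoc]
        refine mul_le_mul_of_nonneg_left (mul_le_mul_of_nonneg_left ?_ (N.channelProb_nonneg H))
          (Finset.prod_nonneg fun _ _ => by positivity)
        by_cases h : σ.AllServed B Q H
        · rw [if_neg (not_not.2 (decoded_code W h hQ hbit k))]
          positivity
        · rw [if_pos h]
          split_ifs <;> norm_num
    _ = _ := by rw [← Finset.sum_mul, Code.sum_inv_card hL, one_mul]

end Schedule

end RelayNetwork

/-! ### Error probability and existence of schedules -/

namespace RelayNetwork

variable {N : RelayNetwork}

theorem matrixProb_eq (hp : ∀ m j i, N.p m j i = 1 / 2) (m : Fin N.M) (A : N.ChannelMatrix m) :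
    N.matrixProb m A = ((2 : ℝ) ^ (N.K (m + 1) * N.K m))⁻¹ := by
  have h : ∀ j i, (if A j i = 1 then N.p m j i else 1 - N.p m j i) = (2 : ℝ)⁻¹ := by
    intro j i
    rw [hp]
    split_ifs <;> norm_num
  simp only [matrixProb, h]
  simp [← pow_mul, mul_comm]

theorem avgRank_eq (hp : ∀ m j i, N.p m j i = 1 / 2) (m : Fin N.M) :
    N.avgRank m = ((2 : ℝ) ^ (N.K (m + 1) * N.K m))⁻¹ *
      ∑ A : N.ChannelMatrix m, (A.rank : ℝ) := by
  simp only [avgRank, matrixProb_eq hp, Finset.mul_sum]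

/-- In a block of length `B`, a channel matrix is unlikely to occur much less often than
expected. -/
theorem sum_channelProb_timesOf_le {n B β : ℕ} (hB : 0 < B) (hβ : (β + 1) * B ≤ n) (m : Fin N.M)
    (G : N.ChannelMatrix m) {l : ℝ} (hl : l < 1) (hG : 0 < N.matrixProb m G) :
    ∑ H : N.ChannelSeq n, N.channelProb H *
      (if ((timesOf B H m β G).card : ℝ) < l * B * N.matrixProb m G then 1 else 0) ≤
      1 / ((1 - l) * N.matrixProb m G) ^ 2 * (1 / B) := by
  classical
  set μ := N.matrixProb m G
  have hB' : (0 : ℝ) < B := by exact_mod_cast hB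
  have hl' : 0 < 1 - l := by linarith
  set S := Finset.univ.filter fun t : Fin n => (t : ℕ) / B = β with hS
  have hcard : S.card = B := by
    rw [← Fintype.card_fin B, ← Finset.card_univ]
    have hlt : ∀ i : Fin B, B * β + i < n := fun i => by
      have := i.isLt
      nlinarith
    symm
    refine Finset.card_bij (fun i _ => (⟨B * β + i, hlt i⟩ : Fin n)) ?_ ?_ ?_
    · intro i _
      simp [hS, Nat.mul_add_div hB, Nat.div_eq_of_lt i.isLt]
    · intro i _ j _ h
      have := congrArg Fin.val h
      simp only at this
      exact Fin.ext (by omega)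
    · intro t ht
      have h1 : (t : ℕ) / B = β := (Finset.mem_filter.1 ht).2
      exact ⟨⟨t % B, Nat.mod_lt _ hB⟩, Finset.mem_univ _,
        Fin.ext (by simp only; rw [← h1, Nat.div_add_mod])⟩
  -- An indicator has variance at most one, and falling below `l * B * μ` is a deviation of at least
  -- `(1 - l) * μ * B`.
  have h := N.chebyshev_channelProb (n := n) m (g := fun A => if A = G then 1 else 0) (μ := μ)
    (V := 1) (a := (1 - l) * μ * B) (by simp [μ]) ?_ (by positivity) S
    (fun H => ((timesOf B H m β G).card : ℝ) < l * B * μ) ?_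
  · refine h.trans (le_of_eq ?_)
    rw [hcard]
    field_simp
  · refine le_trans ?_ (N.sum_matrixProb m).le
    refine Finset.sum_le_sum fun A _ => mul_le_of_le_one_right (N.matrixProb_nonneg m A) ?_
    have h1 : μ ≤ 1 := by
      rw [← N.sum_matrixProb m]
      exact Finset.single_le_sum (fun A _ => N.matrixProb_nonneg m A) (Finset.mem_univ G)
    split_ifs <;> nlinarith
  · intro H hH
    have h1 : ∑ t ∈ S, (if H t m = G then (1 : ℝ) else 0) = (timesOf B H m β G).card := by
      rw [Finset.sum_boole, hS, Finset.filter_filter]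
      rfl
    rw [h1, hcard, abs_sub_comm]
    refine le_trans ?_ (le_abs_self _)
    nlinarith

-- An unserved slot asks for an occurrence beyond those present, although its number is below `l * B
-- * p`, where `p` is the probability of its matrix. So this matrix is too rare in that block; take
-- a union bound over hops, blocks and matrices.
open Classical in
theorem Schedule.sum_not_allServed_le {S : Type} (σ : N.Schedule S) {n B Q : ℕ} (hB : 0 < B)
    (hQ : Q * B ≤ n) {l : ℝ} (hl : l < 1) (hpos : ∀ m (G : N.ChannelMatrix m), 0 < N.matrixProb m G)
    (hpick : ∀ m s, ((σ.pick m s).2 : ℝ) < l * B * N.matrixProb m (σ.pick m s).1) :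
    ∑ H : N.ChannelSeq n, N.channelProb H * (if ¬ σ.AllServed B Q H then 1 else 0) ≤
      (∑ m, ∑ _β : Fin Q, ∑ G : N.ChannelMatrix m, 1 / ((1 - l) * N.matrixProb m G) ^ 2) *
        (1 / B) := by
  have hunion : ∀ H : N.ChannelSeq n, (if ¬ σ.AllServed B Q H then (1 : ℝ) else 0) ≤
      ∑ m, ∑ β : Fin Q, ∑ G : N.ChannelMatrix m,
        if ((timesOf B H m β G).card : ℝ) < l * B * N.matrixProb m G then 1 else 0 := by
    intro H
    have hnn : ∀ m, ∀ β : Fin Q, ∀ G : N.ChannelMatrix m, (0 : ℝ) ≤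
        if ((timesOf B H m β G).card : ℝ) < l * B * N.matrixProb m G then 1 else 0 :=
      fun _ _ _ => by positivity
    by_cases h : σ.AllServed B Q H
    · rw [if_neg (not_not.2 h)]
      exact Finset.sum_nonneg fun m _ => Finset.sum_nonneg fun β _ =>
        Finset.sum_nonneg fun G _ => hnn m β G
    · rw [if_pos h]
      unfold AllServed at h
      push Not at h
      obtain ⟨m, β, hβ, s, hs⟩ := h
      have hlt : ((timesOf B H m β (σ.pick m s).1).card : ℝ) <
          l * B * N.matrixProb m (σ.pick m s).1 := by
        refine lt_of_le_of_lt ?_ (hpick m s)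
        rw [Nat.cast_le]
        by_contra! hcon
        obtain ⟨t, h1, h2, h3⟩ := exists_occurrence_eq hcon
        exact hs t h1 (Prod.ext h2.symm h3.symm)
      refine le_trans ?_ (Finset.single_le_sum (fun m _ => Finset.sum_nonneg fun β _ =>
        Finset.sum_nonneg fun G _ => hnn m β G) (Finset.mem_univ m))
      refine le_trans ?_ (Finset.single_le_sum (fun β _ =>
        Finset.sum_nonneg fun G _ => hnn m β G) (Finset.mem_univ ⟨β, hβ⟩))
      refine le_trans ?_ (Finset.single_le_sum (fun G _ => hnn m ⟨β, hβ⟩ G)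
        (Finset.mem_univ (σ.pick m s).1))
      rw [if_pos hlt]
  refine (Finset.sum_le_sum fun H _ =>
    mul_le_mul_of_nonneg_left (hunion H) (N.channelProb_nonneg H)).trans ?_
  simp_rw [Finset.mul_sum, Finset.sum_mul]
  rw [Finset.sum_comm]
  refine Finset.sum_le_sum fun m _ => ?_
  rw [Finset.sum_comm]
  refine Finset.sum_le_sum fun β _ => ?_
  rw [Finset.sum_comm]
  refine Finset.sum_le_sum fun G _ => ?_
  exact sum_channelProb_timesOf_le hB ((Nat.mul_le_mul_right B β.isLt).trans hQ) m G hl (hpos m G)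

theorem Code.errorProb_nonneg {n : ℕ} {L : Fin (N.K 0) → ℕ} (c : N.Code n L) (k : Fin (N.K 0)) :
    0 ≤ c.errorProb k :=
  Finset.sum_nonneg fun W _ => Finset.sum_nonneg fun H _ =>
    mul_nonneg (mul_nonneg (Finset.prod_nonneg fun _ _ => by positivity) (N.channelProb_nonneg H))
      (by positivity)

theorem Code.nonempty {n : ℕ} {L : Fin (N.K 0) → ℕ} (hL : ∀ k, 0 < L k) : Nonempty (N.Code n L) :=
  ⟨⟨fun _ _ _ _ => 0, fun _ _ _ _ _ _ => 0, fun k _ _ => ⟨0, hL k⟩⟩⟩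

/-- A schedule in which enough slots are available to every source gives a code whose errors are
due to slots that are not served. -/
theorem Schedule.exists_code {S : Type} [Fintype S] (σ : N.Schedule S) (n B Q : ℕ)
    {L : Fin (N.K 0) → ℕ} (hL : ∀ k, 0 < L k) (hQ : N.M ≤ Q)
    (hcard : ∀ k, L k ≤ 2 ^ ((Q - (N.M - 1)) *
      Nat.card {s // k ∈ Set.range (σ.frame 0 (Nat.zero_le _) s).1})) :
    open Classical in
    ∃ c : N.Code n L, ∀ k, c.errorProb k ≤
      ∑ H : N.ChannelSeq n, N.channelProb H * (if ¬ σ.AllServed B Q H then 1 else 0) := by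
  classical
  set Q' := Q - (N.M - 1) with hQ'
  -- Messages are encoded injectively as tables of bits, one for each decoded block and each slot in
  -- which the source is active.
  have hemb : ∀ k, Nonempty (Fin (L k) ↪
      (Fin Q' × {s // k ∈ Set.range (σ.frame 0 (Nat.zero_le _) s).1} → ZMod 2)) := by
    intro k
    refine Function.Embedding.nonempty_of_card_le ?_
    rw [Fintype.card_fin, Fintype.card_fun, Fintype.card_prod, Fintype.card_fin, ZMod.card,
      ← Nat.card_eq_fintype_card]
    exact hcard k
  have emb := fun k => (hemb k).some
  refine ⟨σ.code B hL (fun k w β s =>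
    if h : β < Q' ∧ k ∈ Set.range (σ.frame 0 (Nat.zero_le _) s).1 then
      emb k w (⟨β, h.1⟩, ⟨s, h.2⟩) else 0) Q', fun k => errorProb_code_le (by omega) ?_ k⟩
  intro k w w' h
  refine (emb k).injective (funext ?_)
  rintro ⟨⟨β, hβ⟩, ⟨s, hs⟩⟩
  have := h β hβ s hs
  rwa [dif_pos ⟨hβ, hs⟩, dif_pos ⟨hβ, hs⟩] at this

theorem Chain.frame_lastHop {s : ℕ} (θ : N.Chain s) :
    θ.frame (N.lastHop + 1) N.lastHop.isLt = castFrame N.K_lastHop.symm (θ.frame 0 N.M.zero_le) := by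
  have h0 : θ.frame 0 N.M.zero_le = θ.2 N.firstHop := θ.frame_of_lt N.firstHop
  have hlast : ¬ (N.lastHop : ℕ) + 1 < N.M := by
    have := N.M_pos
    simp only [lastHop]
    omega
  rw [h0, Chain.frame, dif_neg hlast]
  rfl

theorem exists_schedule (hM : 2 ≤ N.M) {a b s : ℕ} (hsa : s ≤ a) (hsb : s ≤ b)
    (h : ∀ m : Fin N.M, (a ≤ N.K m ∧ b ≤ N.K (m + 1)) ∨ (b ≤ N.K m ∧ a ≤ N.K (m + 1)))
    {x Γ : ℝ} (hx : 0 ≤ x) (hΓ : ∀ m : Fin N.M, (Fintype.card (N.ChannelMatrix m) : ℝ) ≤ Γ) :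
    ∃ σ : N.Schedule (Σ θ : N.Chain s, Fin ⌊x * chainWeight b a θ - Γ⌋₊),
      (∀ i, Set.range (σ.frame 0 N.M.zero_le i).1 = Set.range (i.1.frame 0 N.M.zero_le).1) ∧
      ∀ m i, ((σ.pick m i).2 : ℝ) < x * ((2 : ℝ) ^ (N.K (m + 1) * N.K m))⁻¹ := by
  choose w hw0 hw1 hw2 hw3 using exists_chain_weights hM hsa hsb h
  choose pick hinj hpick using fun m =>
    exists_pick hx (hw0 m) (hw2 m) (hw3 m) (hΓ m)
  refine ⟨⟨fun i => i.1.1, fun m hm i => i.1.frame m hm, pick, hinj,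
    fun m i => hw1 m _ _ (hpick m i).1, ?_, ?_⟩, fun _ => rfl, fun m i => (hpick m i).2⟩
  · intro i j
    rw [Chain.frame_lastHop]
    rfl
  · intro i
    rw [Chain.frame_lastHop]
    rfl

end RelayNetwork

/-! ### Achievable rates -/

namespace RelayNetwork

variable {N : RelayNetwork}

open Classical in
/-- The total weight of the chains in which source `k` is active. -/
noncomputable def sourceWeight (b a s : ℕ) (k : Fin (N.K 0)) : ℝ :=
  ∑ θ : N.Chain s,
    if k ∈ Set.range (θ.frame 0 N.M.zero_le).1 then chainWeight b a θ else 0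

theorem sourceWeight_nonneg (b a s : ℕ) (k : Fin (N.K 0)) : 0 ≤ sourceWeight b a s k :=
  Finset.sum_nonneg fun θ _ => by
    split_ifs
    · exact chainWeight_nonneg b a θ
    · exact le_rfl

theorem sum_sourceWeight (b a s : ℕ) :
    ∑ k : Fin (N.K 0), sourceWeight b a s k = ∑ θ : N.Chain s, chainWeight b a θ * (θ.1 : ℕ) := by
  classical
  simp only [sourceWeight]
  rw [Finset.sum_comm]
  refine Finset.sum_congr rfl fun θ _ => ?_
  rw [← Finset.sum_filter, Finset.sum_const, nsmul_eq_mul, mul_comm]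
  congr 2
  have : (Finset.univ.filter fun k => k ∈ Set.range (θ.frame 0 N.M.zero_le).1)
      = Finset.univ.map (θ.frame 0 N.M.zero_le).1 := by
    ext k; simp
  rw [this, Finset.card_map, Finset.card_univ, Fintype.card_fin]

/-- Rounding costs at most `Γ + 1` slots per chain, a loss independent of `x` and so negligible for
long blocks. -/
theorem le_card_active (b a s : ℕ) (k : Fin (N.K 0)) {x Γ : ℝ} (hΓ : 0 ≤ Γ) :
    x * sourceWeight b a s k - Fintype.card (N.Chain s) * (Γ + 1) ≤
      Nat.card {i : Σ θ : N.Chain s, Fin ⌊x * chainWeight b a θ - Γ⌋₊ //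
        k ∈ Set.range (i.1.frame 0 N.M.zero_le).1} := by
  classical
  rw [Nat.card_eq_fintype_card, Fintype.card_subtype, Finset.card_filter, Nat.cast_sum,
    Fintype.sum_sigma, sourceWeight, Finset.mul_sum]
  have hc : (Fintype.card (N.Chain s) : ℝ) * (Γ + 1) = ∑ _θ : N.Chain s, (Γ + 1) := by
    rw [Finset.sum_const, Finset.card_univ, nsmul_eq_mul]
  rw [hc, ← Finset.sum_sub_distrib]
  refine Finset.sum_le_sum fun θ _ => ?_
  dsimp only
  split_ifs with h
  · simp only [Nat.cast_one, Finset.sum_const, Finset.card_univ, Fintype.card_fin, nsmul_eq_mul,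
      mul_one]
    have := Nat.sub_one_lt_floor (x * chainWeight b a θ - Γ)
    linarith
  · simp only [Nat.cast_zero, Finset.sum_const_zero]
    linarith

theorem numMessages_le_two_pow {n : ℕ} {r : ℝ} {c : ℕ} (h : n * r ≤ c) :
    numMessages n r ≤ 2 ^ c := by
  refine Nat.ceil_le.2 ?_
  push_cast
  rw [← Real.rpow_natCast]
  exact Real.rpow_le_rpow_of_exponent_le one_le_two h

/-- The case `q = 0` is split off because the inequality fails there when `D` and `Q'` are positive.
Otherwise both sides grow linearly, the right one faster, and this absorbs `D` and the remainder of
`n` modulo `Q`. -/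
theorem eventually_mul_le_mul_div (Q Q' : ℕ) (hQ : 0 < Q) {κ l q D : ℝ}
    (hq : 0 ≤ q) (hκ : κ * Q < l * Q') :
    q = 0 ∨ ∀ᶠ n : ℕ in atTop, n * (κ * q) ≤ Q' * (l * (n / Q : ℕ) * q - D) := by
  rcases hq.eq_or_lt with h | h
  · exact Or.inl h.symm
  refine Or.inr ?_
  have hQ' : (0 : ℝ) < Q := by exact_mod_cast hQ
  have hpos : 0 < (l * Q' - κ * Q) * q := mul_pos (by linarith) h
  have ht : Tendsto (fun n : ℕ => ((n / Q : ℕ) : ℝ) * ((l * Q' - κ * Q) * q)) atTop atTop :=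
    (tendsto_natCast_atTop_atTop.comp (Nat.tendsto_div_const_atTop hQ.ne')).atTop_mul_const hpos
  filter_upwards [ht.eventually_ge_atTop (Q' * D + |κ| * Q * q)] with n hn
  have h1 : (n : ℝ) = Q * (n / Q : ℕ) + (n % Q : ℕ) := by
    exact_mod_cast (Nat.div_add_mod n Q).symm
  have h2 : ((n % Q : ℕ) : ℝ) ≤ Q := by exact_mod_cast (Nat.mod_lt n hQ).le
  have h3 : ((n % Q : ℕ) : ℝ) * (κ * q) ≤ |κ| * Q * q := by
    calc _ ≤ ((n % Q : ℕ) : ℝ) * (|κ| * q) := by gcongr; exact le_abs_self κ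
      _ ≤ Q * (|κ| * q) := by gcongr
      _ = _ := by ring
  rw [h1, add_mul]
  linarith

/-- Slots are planned for a fraction `l` of the expected occurrences, with `κ < l < 1`. The margin
`1 - l` pays for random fluctuations, the gap `l - κ` for rounding and for the `M - 1` blocks lost
to the pipeline. The number `Q` of blocks is fixed while their length `n / Q` grows. -/
theorem achievable_sourceWeight (hM : 2 ≤ N.M) (hp : ∀ m j i, N.p m j i = 1 / 2) {a b s : ℕ}
    (hsa : s ≤ a) (hsb : s ≤ b)
    (h : ∀ m : Fin N.M, (a ≤ N.K m ∧ b ≤ N.K (m + 1)) ∨ (b ≤ N.K m ∧ a ≤ N.K (m + 1)))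
    {κ : ℝ} (hκ0 : 0 ≤ κ) (hκ1 : κ < 1) :
    N.Achievable fun k => κ * sourceWeight b a s k := by
  classical
  refine ⟨fun k => mul_nonneg hκ0 (sourceWeight_nonneg b a s k), ?_⟩
  obtain ⟨l, hκl, hl1⟩ := exists_between hκ1
  have hl0 : 0 ≤ l := hκ0.trans hκl.le
  -- The bound is `κ * Q < l * (Q - (M - 1))` solved for `Q`.
  obtain ⟨Q₀, hQ₀⟩ := exists_nat_gt (l * (N.M - 1 : ℕ) / (l - κ))
  set Q := Q₀ + N.M with hQdef
  set Q' := Q - (N.M - 1) with hQ'def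
  have hQ0 : 0 < Q := by omega
  have hQQ : κ * Q < l * Q' := by
    rw [div_lt_iff₀ (by linarith)] at hQ₀
    have h1 : (Q : ℝ) = Q' + (N.M - 1 : ℕ) := by
      rw [← Nat.cast_add]
      congr 1
      omega
    have h2 : (Q₀ : ℝ) ≤ Q := by exact_mod_cast Nat.le_add_right _ _
    have h3 : (Q₀ : ℝ) * (l - κ) ≤ Q * (l - κ) :=
      mul_le_mul_of_nonneg_right h2 (by linarith)
    rw [h1] at h3 ⊢
    linarith
  set Γ : ℝ := ∑ m : Fin N.M, (Fintype.card (N.ChannelMatrix m) : ℝ)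
  have hΓ : ∀ m : Fin N.M, (Fintype.card (N.ChannelMatrix m) : ℝ) ≤ Γ := fun m =>
    Finset.single_le_sum (f := fun m : Fin N.M => (Fintype.card (N.ChannelMatrix m) : ℝ))
      (fun _ _ => by positivity) (Finset.mem_univ m)
  have hΓ0 : 0 ≤ Γ := Finset.sum_nonneg fun _ _ => by positivity
  have hpos : ∀ m (G : N.ChannelMatrix m), 0 < N.matrixProb m G := fun m G => by
    rw [matrixProb_eq hp]; positivity
  set C : ℝ := ∑ m, ∑ _β : Fin Q, ∑ G : N.ChannelMatrix m, 1 / ((1 - l) * N.matrixProb m G) ^ 2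
  have hev : ∀ᶠ n : ℕ in atTop, ∃ c : N.Code n (fun k => numMessages n (κ * sourceWeight b a s k)),
      ∀ k, c.errorProb k ≤ C * (1 / (n / Q : ℕ)) := by
    have hall : ∀ᶠ n : ℕ in atTop, ∀ k : Fin (N.K 0), sourceWeight b a s k = 0 ∨
        n * (κ * sourceWeight b a s k) ≤
          Q' * (l * (n / Q : ℕ) * sourceWeight b a s k - Fintype.card (N.Chain s) * (Γ + 1)) := by
      rw [eventually_all]
      intro k
      rcases eventually_mul_le_mul_div (D := Fintype.card (N.Chain s) * (Γ + 1)) Q Q' hQ0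
        (sourceWeight_nonneg b a s k) hQQ with h0 | h0
      · exact Eventually.of_forall fun _ => Or.inl h0
      · exact h0.mono fun _ => Or.inr
    filter_upwards [hall, eventually_ge_atTop Q] with n hn hnQ
    have hB : 0 < n / Q := Nat.div_pos hnQ hQ0
    obtain ⟨σ, hσ1, hσ2⟩ := exists_schedule (x := l * (n / Q : ℕ)) hM hsa hsb h (by positivity) hΓ
    obtain ⟨c, hc⟩ := σ.exists_code n (n / Q) Q
      (L := fun k => numMessages n (κ * sourceWeight b a s k)) (fun k => numMessages_pos _ _)
      (by omega) (by
        intro k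
        refine numMessages_le_two_pow ?_
        push_cast
        rcases hn k with h0 | h0
        · rw [h0, mul_zero, mul_zero]
          positivity
        · refine h0.trans (mul_le_mul_of_nonneg_left ?_ (by positivity))
          simp_rw [hσ1]
          exact le_card_active b a s k hΓ0)
    refine ⟨c, fun k => (hc k).trans ?_⟩
    exact σ.sum_not_allServed_le hB (Nat.mul_div_le n Q) hl1 hpos fun m i => by
      rw [matrixProb_eq hp]
      exact hσ2 m i
  -- Lengths without a good code, which are not eventually present, receive an arbitrary code.
  have hcode : ∀ n : ℕ, ∃ c : N.Code n (fun k => numMessages n (κ * sourceWeight b a s k)),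
      (∃ c : N.Code n (fun k => numMessages n (κ * sourceWeight b a s k)),
        ∀ k, c.errorProb k ≤ C * (1 / (n / Q : ℕ))) → ∀ k, c.errorProb k ≤ C * (1 / (n / Q : ℕ)) := by
    intro n
    by_cases hex : ∃ c : N.Code n (fun k => numMessages n (κ * sourceWeight b a s k)),
      ∀ k, c.errorProb k ≤ C * (1 / (n / Q : ℕ))
    · exact ⟨hex.choose, fun _ => hex.choose_spec⟩
    · exact ⟨(Code.nonempty fun k => numMessages_pos _ _).some, fun h => absurd h hex⟩
  choose c hc using hcode
  refine ⟨c, fun k => ?_⟩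
  have hlim : Tendsto (fun n : ℕ => C * (1 / ((n / Q : ℕ) : ℝ))) atTop (𝓝 (C * 0)) :=
    (tendsto_one_div_atTop_nhds_zero_nat.comp (Nat.tendsto_div_const_atTop hQ0.ne')).const_mul C
  rw [mul_zero] at hlim
  exact tendsto_of_tendsto_of_tendsto_of_le_of_le' tendsto_const_nhds hlim
    (Eventually.of_forall fun n => (c n).errorProb_nonneg k)
    (hev.mono fun n hn => hc n hn k)

end RelayNetwork

theorem corollary2 (N : RelayNetwork) (hM : 2 ≤ N.M)
    (m₀ : Fin N.M) (hm₀ : N.IsMinDimBottleneck m₀)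
    (hp : ∀ m j i, N.p m j i = 1 / 2) :
    N.IsSumCapacity
      (((2 : ℝ) ^ (N.K (m₀ + 1) * N.K m₀))⁻¹ *
        ∑ H : Matrix (Fin (N.K (m₀ + 1))) (Fin (N.K m₀)) (ZMod 2), (H.rank : ℝ)) ∧
    N.avgRank m₀ =
      ((2 : ℝ) ^ (N.K (m₀ + 1) * N.K m₀))⁻¹ *
        ∑ H : Matrix (Fin (N.K (m₀ + 1))) (Fin (N.K m₀)) (ZMod 2), (H.rank : ℝ) := by
  have havg := N.avgRank_eq hp m₀
  refine ⟨?_, havg⟩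
  rw [← havg]
  constructor
  · rintro _ ⟨R, hR, rfl⟩
    exact hR.sum_le_avgRank m₀
  · intro C hC
    set a := N.K m₀
    set b := N.K (m₀ + 1)
    have hK : ∀ m : Fin N.M, min a b ≤ N.K m := fun m => by
      rcases hm₀.dims m with h | h
      · exact (min_le_left _ _).trans h.1
      · exact (min_le_right _ _).trans h.1
    have hach : ∀ κ : ℝ, 0 ≤ κ → κ < 1 → κ * N.avgRank m₀ ≤ C := by
      intro κ hκ0 hκ1
      have h := RelayNetwork.achievable_sourceWeight hM hp (min_le_left a b) (min_le_right a b)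
        hm₀.dims hκ0 hκ1
      refine hC ⟨_, h, ?_⟩
      rw [← Finset.mul_sum, RelayNetwork.sum_sourceWeight,
        RelayNetwork.sum_chainWeight_mul rfl hK, havg]
    -- The scheme covers only `κ < 1`, so an upper bound `C` is compared with the average rank in
    -- the limit from below.
    have hlim : Tendsto (fun κ : ℝ => κ * N.avgRank m₀) (𝓝[<] 1) (𝓝 (1 * N.avgRank m₀)) :=
      (tendsto_id.mul_const _).mono_left nhdsWithin_le_nhds
    rw [one_mul] at hlim
    refine le_of_tendsto hlim ?_
    filter_upwards [Ioo_mem_nhdsLT (zero_lt_one' ℝ)] with κ hκ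
    exact hach κ hκ.1.le hκ.2
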